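/- **Setting.** Let $G$ be a connected undirected graph on $m$ nodes with Laplacian $\bar W$, let $W=\bar W\otimes I_n$, let $\lambda_{\max}(W)$ and $\lambda_{\min}^+(W)$ be its largest and smallest positive eigenvalue, and $\chi(W)=\lambda_{\max}(W)/\lambda_{\min}^+(W)$. Let $F(\mathbf x)=\sum_{i=1}^m f_i(x_i)$ for $\mathbf x=(x_1,\dots,x_m)\in\mathbb R^{nm}$ be $\mu$-strongly convex, let $\mathbf x^*$ minimize $F$ subject to $x_1=\dots=x_m$ (equivalently $\sqrt W\mathbf x=0$), let $F$ be differentiable at $\mathbf x^*$, and let $M_F=\|\nabla F(\mathbf x^*)\|_2$. Put $\varphi(\mathbf y)=\max_{\mathbf x}\{\langle \mathbf y,\mathbf x\rangle-F(\mathbf x)\}$, $\mathbf x(\mathbf y)=\arg\max_{\mathbf x}\{\langle \mathbf y,\mathbf x\rangle-F(\mathbf x)\}$ and $\psi(\mathbf y)=\varphi(\sqrt W\mathbf y)$; let $\nabla\psi$ be $L_\psi$-Lipschitz with $0<L_\psi\le\lambda_{\max}(W)/\mu$ (the choice $L_\psi=\lambda_{\max}(W)/\mu$ is always possible if $m\ge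 2$ and $n\ge 1$). Let $\mathbf y^*$ minimize $\psi$, and let $R_{\mathbf y}>0$ satisfy $\|\mathbf y^*\|_2\le R_{\mathbf y}\le M_F/\sqrt{\lambda_{\min}^+(W)}$. **Oracle.** Let $\xi$ be a random variable and let $\varphi(\mathbf y,\xi)=\max_{\mathbf x}\{\langle\mathbf y,\mathbf x\rangle-F(\mathbf x,\xi)\}$ be differentiable in $\mathbf y$, with $\mathbb E_\xi\varphi(\mathbf y,\xi)=\varphi(\mathbf y)$ for all $\mathbf y$; let $\mathbf x(\mathbf y,\xi)$ be the maximizer and $\psi(\mathbf y,\xi)=\varphi(\sqrt W\mathbf y,\xi)$. Assume $\mathbb E_\xi\exp(\|\mathbf x(\mathbf y,\xi)-\mathbf x(\mathbf y)\|_2^2/\sigma_{\mathbf x}^2)\le e$ for all $\mathbf y$, where $\sigma_{\mathbf x}>0$, and put $\sigma_\psi^2=\lambda_{\max}(W)\sigma_{\mathbf x}^2$. **Algorithm.** Start with $\mathbf y^0=\boldsymbol\zeta^0=\boldsymbol\lambda^0=0$, $A_0=\alpha_0=0$. For $k=0,\dots,N-1$ let $\alpha_{k+1}>0$ solve $A_{k+1}=A_k+\alpha_{k+1}=2L_\psi\alpha_{k+1}^2$,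 draw fresh i.i.d. copies $\xi^{k+1}_1,\dots,\xi^{k+1}_{r_{k+1}}$ of $\xi$, and set $$\boldsymbol\lambda^{k+1}=\tfrac{\alpha_{k+1}\boldsymbol\zeta^k+A_k\mathbf y^k}{A_{k+1}},\quad \boldsymbol\zeta^{k+1}=\boldsymbol\zeta^k-\tfrac{\alpha_{k+1}}{r_{k+1}}\sum_{s=1}^{r_{k+1}}\nabla\psi(\boldsymbol\lambda^{k+1},\xi^{k+1}_s),\quad \mathbf y^{k+1}=\tfrac{\alpha_{k+1}\boldsymbol\zeta^{k+1}+A_k\mathbf y^k}{A_{k+1}}.$$ The output is $\mathbf x^N=\frac1{A_N}\sum_{k=1}^N\frac{\alpha_k}{r_k}\sum_{s=1}^{r_k}\mathbf x(\sqrt W\boldsymbol\lambda^k,\xi^k_s)$. One oracle call per node is made for each sample, so that the number of calls per node is $\sum_{k=1}^N r_k$. **Theorem.** There is an absolute constant $K>0$ such that for every $H\ge K$ there is $\kappa>0$ (depending only on $H$), for every $\rho>0$ there is $c_0>0$ (depending only on $H,\rho$), and for every $c_1\ge c_0$ there is $C>0$ (depending only on $H,\rho,c_1$), such that the following holds in the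 setting above. Let $\varepsilon>0$, $\delta\in(0,1/4)$, let the number of iterations $N$ satisfy $\ln(N/\delta)\ge3$ and $$K\sqrt{L_\psi R_{\mathbf y}^2/\varepsilon}\le N\le H\sqrt{L_\psi R_{\mathbf y}^2/\varepsilon},$$ let $r_k\ge c_0\max\{1,\sigma_\psi^2\alpha_k\ln(N/\delta)/\varepsilon\}$ for $k=1,\dots,N$, and let $F$ be $L_F$-Lipschitz on $\{\mathbf x:\|\mathbf x\|_2\le R_F\}$, where $$R_F\ge\kappa\max\Big\{\frac{R_{\mathbf y}}{A_N}\sqrt{\frac1{\lambda_{\max}(W)}},\ \frac{\sqrt{\lambda_{\max}(W)}\,R_{\mathbf y}}{\mu},\ \|\mathbf x(\sqrt W\mathbf y^*)\|_2\Big\},\qquad L_F\le\rho R_{\mathbf y}\sqrt{\lambda_{\max}(W)}.$$ Then $N\le H\sqrt{\frac{M_F^2}{\mu\varepsilon}\chi(W)}$, and with probability at least $1-4\delta$ $$F(\mathbf x^N)-F(\mathbf x^*)\le\varepsilon\quad\text{and}\quad\|\sqrt W\mathbf x^N\|_2\le\varepsilon/R_{\mathbf y}.$$ If moreover $\mu\varepsilon\le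 M_F^2\chi(W)$ and $r_k\le c_1\max\{1,\sigma_\psi^2\alpha_k\ln(N/\delta)/\varepsilon\}$ for $k=1,\dots,N$, then the number of stochastic oracle calls per node is at most $$C\max\Big\{\frac{\sigma_\psi^2M_F^2}{\varepsilon^2\lambda_{\min}^+(W)}\ln\Big(\frac1\delta\sqrt{\frac{M_F^2}{\mu\varepsilon}\chi(W)}\Big),\ \sqrt{\frac{M_F^2}{\mu\varepsilon}\chi(W)}\Big\}.$$ -/

import Mathlib

open MeasureTheory ProbabilityTheory
open scoped InnerProductSpace Kronecker MatrixOrder NNReal ENNReal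

noncomputable section

namespace DualStoch

/-- Stacked vectors `(x_1, ..., x_m)` with blocks `x_i` in `ℝ^n`, with the Euclidean norm. -/
abbrev Stacked (m n : ℕ) : Type := EuclideanSpace ℝ (Fin m × Fin n)

variable {m n : ℕ}

/-- The `i`-th block of a stacked vector. -/
def block (x : Stacked m n) (i : Fin m) : EuclideanSpace ℝ (Fin n) :=
  WithLp.toLp 2 fun j => x (i, j)

/-- `F(x) = ∑ i, f_i(x_i)`. -/
def stackedSum (f : Fin m → EuclideanSpace ℝ (Fin n) → ℝ) (x : Stacked m n) : ℝ :=
  ∑ i, f i (block x i)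

/-- The consensus subspace `x_1 = ... = x_m`. -/
def consensus (m n : ℕ) : Set (Stacked m n) :=
  {x | ∀ i j, block x i = block x j}

/-- `W`, the Kronecker product of the graph Laplacian with the identity of size `n`. -/
def commMatrix (n : ℕ) (G : SimpleGraph (Fin m)) [DecidableRel G.Adj] :
    Matrix (Fin m × Fin n) (Fin m × Fin n) ℝ :=
  (G.lapMatrix ℝ) ⊗ₖ (1 : Matrix (Fin n) (Fin n) ℝ)

/-- Largest eigenvalue of a symmetric matrix. -/
def lamMax (W : Matrix (Fin m × Fin n) (Fin m × Fin n) ℝ) : ℝ :=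
  sSup (spectrum ℝ W)

/-- Smallest positive eigenvalue of a positive semidefinite matrix. -/
def lamMinPos (W : Matrix (Fin m × Fin n) (Fin m × Fin n) ℝ) : ℝ :=
  sInf {t ∈ spectrum ℝ W | 0 < t}

/-- Condition number `χ(W)` of a positive semidefinite matrix. -/
def condNumber (W : Matrix (Fin m × Fin n) (Fin m × Fin n) ℝ) : ℝ :=
  lamMax W / lamMinPos W

/-- The operator `x ↦ √W x`, with `√W` the positive semidefinite square root of `W`. -/
def sqrtOp (W : Matrix (Fin m × Fin n) (Fin m × Fin n) ℝ) :
    Stacked m n →L[ℝ] Stacked m n :=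
  Matrix.toEuclideanCLM (𝕜 := ℝ) (CFC.sqrt W)

/-- `φ(y) = max_x {⟪y, x⟫ - F(x)}`. -/
def conj (F : Stacked m n → ℝ) (y : Stacked m n) : ℝ :=
  ⨆ x, (⟪y, x⟫_ℝ - F x)

/-- The dual objective `ψ(y) = φ(√W y)`. -/
def dualObj (W : Matrix (Fin m × Fin n) (Fin m × Fin n) ℝ) (F : Stacked m n → ℝ)
    (y : Stacked m n) : ℝ :=
  conj F (sqrtOp W y)

/-- A point where `g` attains its maximum (if there is one). -/
def argmax {β : Type*} [Preorder β] (g : Stacked m n → β) : Stacked m n :=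
  Classical.epsilon fun x => IsMaxOn g Set.univ x

/-- `x(y) = argmax_x {⟪y, x⟫ - F(x)}`. -/
def primalPoint (F : Stacked m n → ℝ) (y : Stacked m n) : Stacked m n :=
  argmax fun x => ⟪y, x⟫_ℝ - F x

/-- A stochastic representation of the dual function of `F`: functions `φ(·, ξ)`, differentiable
in the first variable, with mean `φ`, and functions `F(·, ξ)` (possibly taking the value `+∞`)
such that `φ(y, ξ) = max_x {⟪y, x⟫ - F(x, ξ)}`. -/
structure StochasticDual {Ξ : Type*} [MeasurableSpace Ξ] (ν : Measure Ξ)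
    (F : Stacked m n → ℝ) where
  /-- `φ(y, ξ)` -/
  phi : Stacked m n → Ξ → ℝ
  /-- `F(x, ξ)` -/
  primal : Stacked m n → Ξ → EReal
  measurable_phi : ∀ y, Measurable (phi y)
  differentiable_phi : ∀ ξ, Differentiable ℝ fun y => phi y ξ
  integrable_phi : ∀ y, Integrable (phi y) ν
  integral_phi : ∀ y, ∫ ξ, phi y ξ ∂ν = conj F y
  isGreatest_phi : ∀ y ξ, IsGreatest
    (Set.range fun x : Stacked m n => ((⟪y, x⟫_ℝ : ℝ) : EReal) - primal x ξ) (phi y ξ : EReal)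

section Oracle

variable {Ξ : Type*} [MeasurableSpace Ξ] {ν : Measure Ξ} {F : Stacked m n → ℝ}

/-- `x(y, ξ) = argmax_x {⟪y, x⟫ - F(x, ξ)}`. -/
def StochasticDual.point (S : StochasticDual ν F) (y : Stacked m n) (ξ : Ξ) : Stacked m n :=
  argmax fun x => ((⟪y, x⟫_ℝ : ℝ) : EReal) - S.primal x ξ

/-- `∇ψ(y, ξ)`, the gradient in `y` of `ψ(y, ξ) = φ(√W y, ξ)`. -/
def StochasticDual.gradPsi (S : StochasticDual ν F)
    (W : Matrix (Fin m × Fin n) (Fin m × Fin n) ℝ) (y : Stacked m n) (ξ : Ξ) : Stacked m n :=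
  gradient (fun z => S.phi (sqrtOp W z) ξ) y

/-- Light tails: `E exp(‖x(y, ξ) - x(y)‖² / σ²) ≤ exp 1` for all `y`. -/
def StochasticDual.LightTail (S : StochasticDual ν F) (σ : ℝ) : Prop :=
  ∀ y, ∫⁻ ξ, ENNReal.ofReal (Real.exp (‖S.point y ξ - primalPoint F y‖ ^ 2 / σ ^ 2)) ∂ν
    ≤ ENNReal.ofReal (Real.exp 1)

/-- Mini-batch average `(1/r) ∑_{s<r} ∇ψ(y, ξ_s)`. -/
def StochasticDual.batchGrad (S : StochasticDual ν F)
    (W : Matrix (Fin m × Fin n) (Fin m × Fin n) ℝ) (y : Stacked m n) (ξ : ℕ → Ξ) (r : ℕ) :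
    Stacked m n :=
  (r : ℝ)⁻¹ • ∑ s ∈ Finset.range r, S.gradPsi W y (ξ s)

/-- Mini-batch average `(1/r) ∑_{s<r} x(√W y, ξ_s)`. -/
def StochasticDual.batchPoint (S : StochasticDual ν F)
    (W : Matrix (Fin m × Fin n) (Fin m × Fin n) ℝ) (y : Stacked m n) (ξ : ℕ → Ξ) (r : ℕ) :
    Stacked m n :=
  (r : ℝ)⁻¹ • ∑ s ∈ Finset.range r, S.point (sqrtOp W y) (ξ s)

end Oracle

/-- The pairs `(α_k, A_k)`: `α_0 = A_0 = 0`, and `α_{k+1}` is the positive root of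
`A_k + α = 2 L α²`, with `A_{k+1} = A_k + α_{k+1}`. -/
def coeffs (L : ℝ) : ℕ → ℝ × ℝ
  | 0 => (0, 0)
  | k + 1 =>
    let a := (1 + √(1 + 8 * L * (coeffs L k).2)) / (4 * L)
    (a, (coeffs L k).2 + a)

/-- `α_k` -/
def alpha (L : ℝ) (k : ℕ) : ℝ := (coeffs L k).1

/-- `A_k` -/
def bigA (L : ℝ) (k : ℕ) : ℝ := (coeffs L k).2

theorem bigA_nonneg {L : ℝ} (hL : 0 < L) (k : ℕ) : 0 ≤ bigA L k := by
  induction k with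
  | zero => simp [bigA, coeffs]
  | succ k ih =>
    have : bigA L (k + 1) = bigA L k + (1 + √(1 + 8 * L * bigA L k)) / (4 * L) := rfl
    rw [this]
    positivity

/-- The defining relation `A_{k+1} = A_k + α_{k+1} = 2 L α_{k+1}²` of the step sizes. -/
theorem coeffs_spec {L : ℝ} (hL : 0 < L) (k : ℕ) :
    bigA L (k + 1) = bigA L k + alpha L (k + 1) ∧
      bigA L (k + 1) = 2 * L * alpha L (k + 1) ^ 2 := by
  refine ⟨rfl, ?_⟩
  have h1 : bigA L (k + 1) = bigA L k + alpha L (k + 1) := rfl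
  have h2 : alpha L (k + 1) = (1 + √(1 + 8 * L * bigA L k)) / (4 * L) := rfl
  have h3 : √(1 + 8 * L * bigA L k) ^ 2 = 1 + 8 * L * bigA L k :=
    Real.sq_sqrt (by have := bigA_nonneg hL k; positivity)
  rw [h1, h2]
  generalize √(1 + 8 * L * bigA L k) = s at h3
  field_simp
  nlinarith

/-- State of the algorithm after an iteration; `calls` counts the samples at which the stochastic
oracle has been queried so far (at every query each node evaluates its own block once). -/
structure State (m n : ℕ) where
  lam : Stacked m n
  zeta : Stacked m n
  y : Stacked m n
  calls : ℕ

section Algorithm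

variable {Ξ : Type*} [MeasurableSpace Ξ] {ν : Measure Ξ} {F : Stacked m n → ℝ}

/-- The dual stochastic accelerated gradient method with step parameter `L`, batch sizes `r k` and
samples `ξ k 0, ξ k 1, ...` for the `k`-th iteration, `k = 1, 2, ...`, started at zero. -/
def run (S : StochasticDual ν F) (W : Matrix (Fin m × Fin n) (Fin m × Fin n) ℝ) (L : ℝ)
    (r : ℕ → ℕ) (ξ : ℕ → ℕ → Ξ) : ℕ → State m n
  | 0 => ⟨0, 0, 0, 0⟩
  | k + 1 =>
    let s := run S W L r ξ k
    let lam := (bigA L (k + 1))⁻¹ • (alpha L (k + 1) • s.zeta + bigA L k • s.y)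
    let zeta := s.zeta - alpha L (k + 1) • S.batchGrad W lam (ξ (k + 1)) (r (k + 1))
    let y := (bigA L (k + 1))⁻¹ • (alpha L (k + 1) • zeta + bigA L k • s.y)
    ⟨lam, zeta, y, s.calls + r (k + 1)⟩

/-- The primal output `x^N = (1/A_N) ∑_{k=0}^N α_k x(√W λ^k, {ξ^k_s}_{s<r_k})`, which reuses the
oracle answers of the iterations (`α_0 = 0`). -/
def output (S : StochasticDual ν F) (W : Matrix (Fin m × Fin n) (Fin m × Fin n) ℝ) (L : ℝ)
    (r : ℕ → ℕ) (ξ : ℕ → ℕ → Ξ) (N : ℕ) : Stacked m n :=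
  (bigA L N)⁻¹ • ∑ k ∈ Finset.range (N + 1),
    alpha L k • S.batchPoint W (run S W L r ξ k).lam (ξ k) (r k)

end Algorithm

/-- `max {1, σ_ψ² α_k ln(N/δ) / ε}`, with `σψ2` standing for `σ_ψ²`. -/
def batchScale (L σψ2 ε δ : ℝ) (N k : ℕ) : ℝ :=
  max 1 (σψ2 * alpha L k * Real.log (N / δ) / ε)

end DualStoch

end

/-! The method is an accelerated gradient method for the dual objective `ψ` with inexact gradients.
By strong convexity of `F`, the conjugate `φ` is differentiable with gradient `x(y)`, so `∇ψ(y) = √W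
x(√W y)`. The same computation identifies `x(y, ξ)` with `∇φ(y, ξ)`, and averaging subgradient
inequalities shows that the oracle is unbiased. Each step therefore uses the true gradient plus `√W`
applied to a centred light-tailed error.

One step of the method satisfies a potential inequality for `A_k ψ(y^k) + ‖ζ^k - u‖² / 2` with an
arbitrary comparison point `u` (`SimilarTriangles.step`). Summed with `u = y*`, it keeps the
iterates within `2R` of `y*`. Summed with `u` of norm at most `2R` pointing against `√W x`, where
`x` is the average of the exact points `x(√W λ^k)`, and combined with Jensen's inequality and weak
duality, it bounds both the primal gap and `R ‖√W x‖` by `4R² / A_N` (`DualPair.bounds`). The actual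
output differs from `x` by the averaged noise only, and the Lipschitz condition on `F` transfers the
bound to it (`output_accuracy`). Since `A_N` is of order `N² / L`, taking `N` of order `√(L R² / ε)`
makes the errors at most `ε`.

Three noise terms must be small: the weighted sum of the errors, the sum of their squares, and their
inner products with `y* - ζ^k`. All three follow from one dimension-free tail bound
(`measure_rowSum_ge_le`), obtained by controlling the mean of `cosh ‖θ S‖` one sample at a time. The
directions `y* - ζ^k` are bounded only on the good event; they are truncated first, so that the tail
bound holds unconditionally, and on the good event an induction shows that the truncation never
acts. The batch sizes are proportional to `α_k`, so the accumulated variance is a small multiple of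
`A_N ε`, which is of order `R²`. -/

noncomputable section

set_option linter.unusedSectionVars false

namespace DualStoch

/-! ### Exponential moments of one light-tailed increment -/

section Concentration

/-- `cosh` is a convex function of the square of its argument. -/
theorem cosh_le_of_sq_eq {c p q w : ℝ} (hw0 : 0 ≤ w) (hw1 : w ≤ 1)
    (h : c ^ 2 = w * p ^ 2 + (1 - w) * q ^ 2) :
    Real.cosh c ≤ w * Real.cosh p + (1 - w) * Real.cosh q := by
  refine hasSum_le (fun k => ?_) (Real.hasSum_cosh c)
    (((Real.hasSum_cosh p).mul_left w).add ((Real.hasSum_cosh q).mul_left (1 - w)))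
  have hk := (convexOn_pow k).2 (Set.mem_Ici.2 (sq_nonneg p)) (Set.mem_Ici.2 (sq_nonneg q)) hw0
    (sub_nonneg.2 hw1) (by ring)
  simp only [smul_eq_mul] at hk
  rw [pow_mul, pow_mul, pow_mul, h, ← mul_div_assoc, ← mul_div_assoc, ← add_div]
  gcongr

theorem exp_sub_self_le_exp_sq {b : ℝ} (hb : 0 ≤ b) : Real.exp b - b ≤ Real.exp (b ^ 2) := by
  rcases le_total b 1 with h | h
  · have h1 := Real.abs_exp_sub_one_sub_id_le (x := b) (by rwa [abs_of_nonneg hb])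
    have h2 := Real.add_one_le_exp (b ^ 2)
    have h3 := (abs_le.1 h1).2
    linarith
  · have : Real.exp b ≤ Real.exp (b ^ 2) := Real.exp_le_exp.2 (by nlinarith)
    linarith

variable {E : Type*} [NormedAddCommGroup E] [InnerProductSpace ℝ E]

/-- Pinelis' inequality in a Hilbert space. -/
theorem cosh_norm_add_le (s x : E) :
    Real.cosh ‖s + x‖ ≤ Real.cosh ‖s‖ * (Real.exp ‖x‖ - ‖x‖) +
      Real.sinh ‖s‖ / ‖s‖ * ⟪s, x⟫_ℝ := by
  have hb := norm_nonneg x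
  have hbs : ‖x‖ ≤ Real.sinh ‖x‖ := Real.self_le_sinh_iff.2 hb
  have he : Real.exp ‖x‖ = Real.cosh ‖x‖ + Real.sinh ‖x‖ := (Real.cosh_add_sinh _).symm
  rcases eq_or_ne s 0 with rfl | hs
  · simp only [zero_add, norm_zero, Real.cosh_zero, one_mul, inner_zero_left, mul_zero, add_zero]
    linarith
  rcases eq_or_ne x 0 with rfl | hx
  · simp
  have ha' : 0 < ‖s‖ := norm_pos_iff.2 hs
  have hb' : 0 < ‖x‖ := norm_pos_iff.2 hx
  have hin := abs_le.1 (abs_real_inner_le_norm s x)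
  set a := ‖s‖
  set b := ‖x‖
  obtain ⟨t, ht⟩ : ∃ t, t = ⟪s, x⟫_ℝ / (a * b) := ⟨_, rfl⟩
  have hab : 0 < a * b := mul_pos ha' hb'
  have hti : ⟪s, x⟫_ℝ = t * (a * b) := by rw [ht]; field_simp
  have ht1 : -1 ≤ t := by
    rw [ht, le_div_iff₀ hab]; linarith
  have ht2 : t ≤ 1 := by
    rw [ht, div_le_one hab]; linarith
  -- With `t` the cosine of the angle between `s` and `x`, the squared norm interpolates between the
  -- two collinear cases, so convexity of `cosh √·` reduces the claim to the addition formulas.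
  have hsq : ‖s + x‖ ^ 2 = (1 + t) / 2 * (a + b) ^ 2 + (1 - (1 + t) / 2) * (a - b) ^ 2 := by
    rw [norm_add_sq_real, hti]; ring
  have h := cosh_le_of_sq_eq (by linarith) (by linarith) hsq
  rw [Real.cosh_add, Real.cosh_sub] at h
  have hsa : 0 ≤ Real.sinh a := Real.sinh_nonneg_iff.2 ha'.le
  have hsc : Real.sinh a ≤ Real.cosh a := (Real.sinh_lt_cosh a).le
  have h2 : Real.sinh a / a * (t * (a * b)) = Real.sinh a * t * b := by field_simp
  rw [hti, h2, he]
  -- Write `sinh b = b + (sinh b - b)`. The part with `b` is the inner product, which will average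
  -- out; the remainder is absorbed by `cosh a` because `t sinh a ≤ cosh a`.
  have h3 : t * Real.sinh a * (Real.sinh b - b) ≤ Real.cosh a * (Real.sinh b - b) := by
    refine mul_le_mul_of_nonneg_right ?_ (by linarith)
    nlinarith
  nlinarith

variable {Ξ : Type*} [MeasurableSpace Ξ] {ν : Measure Ξ}

/-- Pointwise bound behind the moment estimate for light-tailed variables. -/
theorem exists_exp_sub_self_le {θ σ : ℝ} (hσ : 0 < σ) :
    ∃ a c : ℝ, 0 ≤ c ∧ a + c * Real.exp 1 ≤ Real.exp (5 / 4 * (θ ^ 2 * σ ^ 2)) ∧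
      ∀ b, 0 ≤ b → Real.exp (|θ| * b) - |θ| * b ≤ a + c * Real.exp (b ^ 2 / σ ^ 2) := by
  set p := θ ^ 2 * σ ^ 2 with hp
  have hp0 : 0 ≤ p := by positivity
  rcases le_total p 1 with h | h
  -- For `p ≤ 1`: `exp x - x ≤ exp (x²)` and `x² = p + p u` with `u = b² / σ² - 1`. Convexity gives
  -- `exp (p u) ≤ 1 - p + p exp u`, and the tail condition makes the mean of `exp u` at most `1`.
  · refine ⟨Real.exp p * (1 - p), Real.exp p * p * Real.exp (-1), by positivity, ?_, ?_⟩
    · have h1 : Real.exp (-1) * Real.exp 1 = 1 := by rw [← Real.exp_add]; simp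
      have : Real.exp p * (1 - p) + Real.exp p * p * Real.exp (-1) * Real.exp 1 = Real.exp p := by
        rw [mul_assoc (Real.exp p * p), h1]; ring
      rw [this]
      exact Real.exp_le_exp.2 (by linarith)
    · intro b hb
      refine (exp_sub_self_le_exp_sq (by positivity)).trans ?_
      have hcv := convexOn_exp.2 (Set.mem_univ (0 : ℝ)) (Set.mem_univ (b ^ 2 / σ ^ 2 - 1))
        (sub_nonneg.2 h) hp0 (by ring)
      simp only [smul_eq_mul, mul_zero, zero_add, Real.exp_zero, mul_one] at hcv
      have h2 : (|θ| * b) ^ 2 = p + p * (b ^ 2 / σ ^ 2 - 1) := by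
        rw [mul_pow, sq_abs, hp]; field_simp; ring
      rw [h2, Real.exp_add]
      have h3 : Real.exp (b ^ 2 / σ ^ 2 - 1) = Real.exp (-1) * Real.exp (b ^ 2 / σ ^ 2) := by
        rw [← Real.exp_add]; congr 1; ring
      rw [h3] at hcv
      calc _ ≤ Real.exp p * (1 - p + p * (Real.exp (-1) * Real.exp (b ^ 2 / σ ^ 2))) := by gcongr
        _ = _ := by ring
  -- For `p ≥ 1`: `|θ| b ≤ p / 4 + b² / σ²`, and the resulting mean `exp (p / 4 + 1)` is at most
  -- `exp (5 p / 4)`. This case fixes the constant `5 / 4`.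
  · refine ⟨0, Real.exp (p / 4), by positivity, ?_, ?_⟩
    · rw [zero_add, ← Real.exp_add]
      exact Real.exp_le_exp.2 (by linarith)
    · intro b hb
      have h1 : |θ| * b ≤ p / 4 + b ^ 2 / σ ^ 2 := by
        have h2 : 0 ≤ (|θ| * σ / 2 - b / σ) ^ 2 := sq_nonneg _
        have h3 : (|θ| * σ / 2 - b / σ) ^ 2 = p / 4 + b ^ 2 / σ ^ 2 - |θ| * b := by
          rw [hp, ← sq_abs θ]; field_simp; ring
        linarith
      have h4 : 0 ≤ |θ| * b := by positivity
      rw [zero_add, ← Real.exp_add]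
      have := Real.exp_le_exp.2 h1
      linarith

theorem integrable_of_lightTail {E : Type*} [NormedAddCommGroup E] [IsFiniteMeasure ν] {X : Ξ → E} {σ : ℝ} (hσ : 0 < σ)
    (hX : AEStronglyMeasurable X ν)
    (htail : ∫⁻ x, ENNReal.ofReal (Real.exp (‖X x‖ ^ 2 / σ ^ 2)) ∂ν
      ≤ ENNReal.ofReal (Real.exp 1)) :
    Integrable (fun x => Real.exp (‖X x‖ ^ 2 / σ ^ 2)) ν ∧
      ∫ x, Real.exp (‖X x‖ ^ 2 / σ ^ 2) ∂ν ≤ Real.exp 1 ∧ Integrable X ν := by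
  have hm : AEStronglyMeasurable (fun x => Real.exp (‖X x‖ ^ 2 / σ ^ 2)) ν := by
    have : Continuous fun v : E => Real.exp (‖v‖ ^ 2 / σ ^ 2) := by fun_prop
    exact this.comp_aestronglyMeasurable hX
  have h0 : 0 ≤ᵐ[ν] fun x => Real.exp (‖X x‖ ^ 2 / σ ^ 2) :=
    ae_of_all _ fun x => (Real.exp_pos _).le
  have hi : Integrable (fun x => Real.exp (‖X x‖ ^ 2 / σ ^ 2)) ν := by
    refine (lintegral_ofReal_ne_top_iff_integrable hm h0).1 ?_
    exact (htail.trans_lt ENNReal.ofReal_lt_top).ne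
  refine ⟨hi, ?_, ?_⟩
  · rw [integral_eq_lintegral_of_nonneg_ae h0 hm]
    exact ENNReal.toReal_le_of_le_ofReal (Real.exp_pos _).le htail
  · refine (hi.const_mul σ).mono' hX (ae_of_all _ fun x => ?_)
    have h1 : ‖X x‖ = σ * (‖X x‖ / σ) := by field_simp
    rw [h1]
    refine mul_le_mul_of_nonneg_left ?_ hσ.le
    have h2 := Real.add_one_le_exp (‖X x‖ ^ 2 / σ ^ 2)
    rw [show (σ * (‖X x‖ / σ)) ^ 2 / σ ^ 2 = ‖X x‖ ^ 2 / σ ^ 2 by field_simp]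
    have h3 : (‖X x‖ / σ) ^ 2 = ‖X x‖ ^ 2 / σ ^ 2 := by field_simp
    nlinarith [sq_nonneg (‖X x‖ / σ - 1 / 2)]

/-- A centred light-tailed increment multiplies the mean of `cosh ‖·‖` by at most
`exp (5 θ² σ² / 4)`. -/
theorem lintegral_cosh_norm_add_le [CompleteSpace E] [IsProbabilityMeasure ν] {X : Ξ → E} {σ : ℝ}
    (hσ : 0 < σ) (hX : AEStronglyMeasurable X ν) (hmean : ∫ x, X x ∂ν = 0)
    (htail : ∫⁻ x, ENNReal.ofReal (Real.exp (‖X x‖ ^ 2 / σ ^ 2)) ∂ν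
      ≤ ENNReal.ofReal (Real.exp 1)) (s : E) (θ : ℝ) :
    ∫⁻ x, ENNReal.ofReal (Real.cosh ‖s + θ • X x‖) ∂ν
      ≤ ENNReal.ofReal (Real.cosh ‖s‖ * Real.exp (5 / 4 * (θ ^ 2 * σ ^ 2))) := by
  obtain ⟨a, c, hc, hac, hb⟩ := exists_exp_sub_self_le (θ := θ) hσ
  obtain ⟨hi, hle, hXi⟩ := integrable_of_lightTail hσ hX htail
  -- An integrable majorant whose inner-product term has mean zero because `X` is centred.
  set J : Ξ → ℝ := fun x => Real.cosh ‖s‖ * (a + c * Real.exp (‖X x‖ ^ 2 / σ ^ 2)) +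
    Real.sinh ‖s‖ / ‖s‖ * (θ * ⟪s, X x⟫_ℝ) with hJ
  have hpt : ∀ x, Real.cosh ‖s + θ • X x‖ ≤ J x := fun x => by
    refine (cosh_norm_add_le s (θ • X x)).trans ?_
    rw [norm_smul, Real.norm_eq_abs, inner_smul_right]
    have := hb ‖X x‖ (norm_nonneg _)
    simp only [hJ]
    gcongr
  have hi1 : Integrable (fun x => Real.cosh ‖s‖ * (a + c * Real.exp (‖X x‖ ^ 2 / σ ^ 2))) ν :=
    ((integrable_const a).add (hi.const_mul c)).const_mul _
  have hi2 : Integrable (fun x => Real.sinh ‖s‖ / ‖s‖ * (θ * ⟪s, X x⟫_ℝ)) ν :=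
    ((hXi.const_inner s).const_mul θ).const_mul _
  have hJi : Integrable J ν := hi1.add hi2
  calc ∫⁻ x, ENNReal.ofReal (Real.cosh ‖s + θ • X x‖) ∂ν
      ≤ ∫⁻ x, ENNReal.ofReal (J x) ∂ν :=
        lintegral_mono fun x => ENNReal.ofReal_le_ofReal (hpt x)
    _ = ENNReal.ofReal (∫ x, J x ∂ν) :=
        (ofReal_integral_eq_lintegral_ofReal hJi
          (ae_of_all _ fun x => (Real.cosh_pos _).le.trans (hpt x))).symm
    _ ≤ _ := by
        refine ENNReal.ofReal_le_ofReal ?_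
        rw [hJ, integral_add hi1 hi2, integral_const_mul, integral_const_mul, integral_const_mul,
          integral_inner hXi, hmean, inner_zero_right, mul_zero, mul_zero, add_zero,
          integral_add (integrable_const a) (hi.const_mul c), integral_const_mul]
        simp only [integral_const, probReal_univ, one_smul]
        refine mul_le_mul_of_nonneg_left (le_trans ?_ hac) (Real.cosh_pos _).le
        gcongr

end Concentration

/-! ### Large deviations of adapted sums of independent samples -/

section RowSums

variable {Ω Ξ 𝒰 E : Type*} [mΩ : MeasurableSpace Ω] [mΞ : MeasurableSpace Ξ] [MeasurableSpace 𝒰]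
  {P : Measure Ω} {ν : Measure Ξ}

/-- This replaces conditioning on the past: by independence the joint law is a product, so Tonelli's
theorem allows `U` to be frozen while the fresh sample is integrated out. -/
theorem lintegral_comp_le_of_indep [IsProbabilityMeasure P] [IsProbabilityMeasure ν]
    {U : Ω → 𝒰} (hU : Measurable U) {x : Ω → Ξ}
    (hx : Measurable x) (hlaw : P.map x = ν) (hI : IndepFun U x P)
    {f : 𝒰 → Ξ → ℝ≥0∞} (hf : Measurable (Function.uncurry f)) {g : 𝒰 → ℝ≥0∞} (hg : Measurable g)
    (hfg : ∀ u, ∫⁻ y, f u y ∂ν ≤ g u) :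
    ∫⁻ ω, f (U ω) (x ω) ∂P ≤ ∫⁻ ω, g (U ω) ∂P := by
  have hmap := (indepFun_iff_map_prod_eq_prod_map_map hU.aemeasurable hx.aemeasurable).1 hI
  have : IsProbabilityMeasure (P.map U) := Measure.isProbabilityMeasure_map hU.aemeasurable
  calc ∫⁻ ω, f (U ω) (x ω) ∂P
      = ∫⁻ p, Function.uncurry f p ∂(P.map fun ω => (U ω, x ω)) := by
        rw [lintegral_map hf (hU.prodMk hx)]; rfl
    _ = ∫⁻ u, ∫⁻ y, f u y ∂ν ∂(P.map U) := by
        rw [hmap, hlaw, lintegral_prod _ hf.aemeasurable]; rfl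
    _ ≤ ∫⁻ u, g u ∂(P.map U) := lintegral_mono hfg
    _ = ∫⁻ ω, g (U ω) ∂P := lintegral_map hg hU

/-- The σ-algebra generated by the samples with index in `T`. -/
abbrev sigmaOf (ξ : ℕ → ℕ → Ω → Ξ) (T : Set (ℕ × ℕ)) : MeasurableSpace Ω :=
  ⨆ p ∈ T, mΞ.comap (ξ p.1 p.2)

theorem sigmaOf_le {ξ : ℕ → ℕ → Ω → Ξ} (hξ : ∀ k s, Measurable (ξ k s)) (T : Set (ℕ × ℕ)) :
    sigmaOf ξ T ≤ mΩ :=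
  iSup₂_le fun p _ => (hξ p.1 p.2).comap_le

theorem sigmaOf_mono (ξ : ℕ → ℕ → Ω → Ξ) {T T' : Set (ℕ × ℕ)} (h : T ⊆ T') :
    sigmaOf ξ T ≤ sigmaOf ξ T' :=
  biSup_mono h

theorem measurable_sample (ξ : ℕ → ℕ → Ω → Ξ) {T : Set (ℕ × ℕ)} {k s : ℕ} (h : (k, s) ∈ T) :
    Measurable[sigmaOf ξ T] (ξ k s) :=
  measurable_iff_comap_le.2 (le_biSup (fun p : ℕ × ℕ => mΞ.comap (ξ p.1 p.2)) h)

theorem indep_sigmaOf {ξ : ℕ → ℕ → Ω → Ξ} (hξ : ∀ k s, Measurable (ξ k s))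
    (hind : iIndepFun (fun p : ℕ × ℕ => ξ p.1 p.2) P) {T : Set (ℕ × ℕ)} {k s : ℕ}
    (h : (k, s) ∉ T) : Indep (sigmaOf ξ T) (mΞ.comap (ξ k s)) P := by
  have := indep_iSup_of_disjoint (fun p : ℕ × ℕ => (hξ p.1 p.2).comap_le) hind
    (Set.disjoint_singleton_right.2 h)
  simpa [sigmaOf] using this

theorem indepFun_sample {ξ : ℕ → ℕ → Ω → Ξ} (hξ : ∀ k s, Measurable (ξ k s))
    (hind : iIndepFun (fun p : ℕ × ℕ => ξ p.1 p.2) P) {T : Set (ℕ × ℕ)} {k s : ℕ}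
    (h : (k, s) ∉ T) {U : Ω → 𝒰} (hU : Measurable[sigmaOf ξ T] U) : IndepFun U (ξ k s) P := by
  rw [IndepFun_iff_Indep]
  exact indep_of_indep_of_le_left (indep_sigmaOf hξ hind h) (measurable_iff_comap_le.1 hU)

/-- The samples of the first `k` rows and the first `t` samples of the next row. -/
def samplesUpTo (k t : ℕ) : Set (ℕ × ℕ) :=
  {p | p.1 ≤ k ∨ p.1 = k + 1 ∧ p.2 < t}

/-- The samples of the first `k` rows. -/
abbrev rowsUpTo (k : ℕ) : Set (ℕ × ℕ) := {p | p.1 ≤ k}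

variable [NormedAddCommGroup E] [InnerProductSpace ℝ E]

/-- Weighted sum over the first `k` rows of increments `h (U j) (ξ j s)`. -/
def rowSum (c : ℕ → ℝ) (r : ℕ → ℕ) (h : 𝒰 → Ξ → E) (U : ℕ → Ω → 𝒰) (ξ : ℕ → ℕ → Ω → Ξ)
    (k : ℕ) (ω : Ω) : E :=
  ∑ j ∈ Finset.range k,
    c (j + 1) • ∑ s ∈ Finset.range (r (j + 1)), h (U (j + 1) ω) (ξ (j + 1) s ω)

variable [MeasurableSpace E] [BorelSpace E] [SecondCountableTopology E]
  {c : ℕ → ℝ} {r : ℕ → ℕ} {h : 𝒰 → Ξ → E} {U : ℕ → Ω → 𝒰} {ξ : ℕ → ℕ → Ω → Ξ} {σ : ℝ}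

theorem measurable_rowPart (hh : Measurable (Function.uncurry h))
    (hU : ∀ k, Measurable[sigmaOf ξ (rowsUpTo k)] (U (k + 1))) (k t : ℕ) :
    Measurable[sigmaOf ξ (samplesUpTo k t)] fun ω =>
      ∑ s ∈ Finset.range t, h (U (k + 1) ω) (ξ (k + 1) s ω) := by
  refine Finset.measurable_fun_sum _ fun s hs => ?_
  have h1 : Measurable[sigmaOf ξ (samplesUpTo k t)] (U (k + 1)) :=
    (hU k).mono (sigmaOf_mono ξ fun p hp => Or.inl hp) le_rfl
  have h2 : Measurable[sigmaOf ξ (samplesUpTo k t)] (ξ (k + 1) s) :=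
    measurable_sample ξ (Or.inr ⟨rfl, Finset.mem_range.1 hs⟩)
  exact hh.comp (h1.prodMk h2)

theorem measurable_rowSum (hh : Measurable (Function.uncurry h))
    (hU : ∀ k, Measurable[sigmaOf ξ (rowsUpTo k)] (U (k + 1))) (k : ℕ) :
    Measurable[sigmaOf ξ (rowsUpTo k)] (rowSum c r h U ξ k) := by
  refine Finset.measurable_fun_sum _ fun j hj => ?_
  refine Measurable.const_smul ?_ _
  refine (measurable_rowPart hh hU j (r (j + 1))).mono (sigmaOf_mono ξ fun p hp => ?_) le_rfl
  have := Finset.mem_range.1 hj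
  rcases hp with hp | hp
  · exact hp.trans (by omega)
  · exact (show p.1 ≤ k by omega)

/-- The samples of a row are added one by one. Each is independent of the preceding partial sum and
of the row parameter, and costs one factor from `lintegral_cosh_norm_add_le`. -/
theorem lintegral_cosh_rowPart_le [CompleteSpace E] [IsProbabilityMeasure P]
    [IsProbabilityMeasure ν]
    (hσ : 0 < σ) (hξ : ∀ k s, Measurable (ξ k s)) (hlaw : ∀ k s, P.map (ξ k s) = ν)
    (hind : iIndepFun (fun p : ℕ × ℕ => ξ p.1 p.2) P)
    (hh : Measurable (Function.uncurry h)) (hmean : ∀ u, ∫ x, h u x ∂ν = 0)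
    (htail : ∀ u, ∫⁻ x, ENNReal.ofReal (Real.exp (‖h u x‖ ^ 2 / σ ^ 2)) ∂ν
      ≤ ENNReal.ofReal (Real.exp 1))
    (hU : ∀ k, Measurable[sigmaOf ξ (rowsUpTo k)] (U (k + 1))) (θ : ℝ) (k t : ℕ) :
    ∫⁻ ω, ENNReal.ofReal (Real.cosh ‖θ • (rowSum c r h U ξ k ω +
        c (k + 1) • ∑ s ∈ Finset.range t, h (U (k + 1) ω) (ξ (k + 1) s ω))‖) ∂P
      ≤ (∫⁻ ω, ENNReal.ofReal (Real.cosh ‖θ • rowSum c r h U ξ k ω‖) ∂P) *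
        ENNReal.ofReal (Real.exp (5 / 4 * (θ ^ 2 * σ ^ 2) * (t * c (k + 1) ^ 2))) := by
  induction t with
  | zero => simp
  | succ t ih =>
    -- The past relevant for the next increment: the partial sum and the parameter at which the
    -- oracle is queried.
    set V : Ω → E × 𝒰 := fun ω => (θ • (rowSum c r h U ξ k ω +
        c (k + 1) • ∑ s ∈ Finset.range t, h (U (k + 1) ω) (ξ (k + 1) s ω)), U (k + 1) ω) with hV
    have hsub : sigmaOf ξ (rowsUpTo k) ≤ sigmaOf ξ (samplesUpTo k t) := sigmaOf_mono ξ fun p hp => Or.inl hp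
    have hVm : Measurable[sigmaOf ξ (samplesUpTo k t)] V := by
      have h1 : Measurable[sigmaOf ξ (samplesUpTo k t)] (rowSum c r h U ξ k) := (measurable_rowSum hh hU k).mono hsub le_rfl
      have h2 := measurable_rowPart hh hU k t
      have h3 : Measurable[sigmaOf ξ (samplesUpTo k t)] fun ω => θ • (rowSum c r h U ξ k ω +
        c (k + 1) • ∑ s ∈ Finset.range t, h (U (k + 1) ω) (ξ (k + 1) s ω)) :=
        (h1.add (h2.const_smul _)).const_smul _
      exact h3.prodMk ((hU k).mono hsub le_rfl)
    have key := lintegral_comp_le_of_indep (P := P) (ν := ν) (hVm.mono (sigmaOf_le hξ _) le_rfl)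
      (hξ (k + 1) t) (hlaw _ _)
      (indepFun_sample hξ hind (T := samplesUpTo k t) (by simp [samplesUpTo]) hVm)
      (f := fun v x => ENNReal.ofReal (Real.cosh ‖v.1 + (θ * c (k + 1)) • h v.2 x‖))
      (g := fun v => ENNReal.ofReal (Real.cosh ‖v.1‖ *
        Real.exp (5 / 4 * ((θ * c (k + 1)) ^ 2 * σ ^ 2))))
      (by
        have hc : Continuous fun v : E => ENNReal.ofReal (Real.cosh ‖v‖) := ENNReal.continuous_ofReal.comp (by fun_prop)
        refine hc.measurable.comp ((measurable_fst.comp measurable_fst).add ?_)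
        exact (hh.comp ((measurable_snd.comp measurable_fst).prodMk measurable_snd)).const_smul _)
      (by
        have hc : Continuous fun v : E => ENNReal.ofReal (Real.cosh ‖v‖ *
          Real.exp (5 / 4 * ((θ * c (k + 1)) ^ 2 * σ ^ 2))) := ENNReal.continuous_ofReal.comp (by fun_prop)
        exact hc.measurable.comp measurable_fst)
      (fun v => lintegral_cosh_norm_add_le hσ
        (hh.comp (measurable_const.prodMk measurable_id)).aestronglyMeasurable
        (hmean v.2) (htail v.2) v.1 _)
    have hl : ∀ ω, θ • (rowSum c r h U ξ k ω +
        c (k + 1) • ∑ s ∈ Finset.range (t + 1), h (U (k + 1) ω) (ξ (k + 1) s ω)) =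
        (V ω).1 + (θ * c (k + 1)) • h (V ω).2 (ξ (k + 1) t ω) := fun ω => by
      simp only [hV, Finset.sum_range_succ, smul_add, mul_smul, add_assoc]
    simp_rw [hl]
    refine key.trans ?_
    simp_rw [ENNReal.ofReal_mul (Real.cosh_pos _).le]
    rw [lintegral_mul_const' _ _ ENNReal.ofReal_ne_top]
    refine (mul_le_mul_left ih _).trans ?_
    rw [mul_assoc, ← ENNReal.ofReal_mul (Real.exp_pos _).le, ← Real.exp_add]
    refine le_of_eq ?_
    congr 3
    push_cast
    ring

theorem lintegral_cosh_rowSum_le [CompleteSpace E] [IsProbabilityMeasure P]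
    [IsProbabilityMeasure ν]
    (hσ : 0 < σ) (hξ : ∀ k s, Measurable (ξ k s)) (hlaw : ∀ k s, P.map (ξ k s) = ν)
    (hind : iIndepFun (fun p : ℕ × ℕ => ξ p.1 p.2) P)
    (hh : Measurable (Function.uncurry h)) (hmean : ∀ u, ∫ x, h u x ∂ν = 0)
    (htail : ∀ u, ∫⁻ x, ENNReal.ofReal (Real.exp (‖h u x‖ ^ 2 / σ ^ 2)) ∂ν
      ≤ ENNReal.ofReal (Real.exp 1))
    (hU : ∀ k, Measurable[sigmaOf ξ (rowsUpTo k)] (U (k + 1))) (θ : ℝ) (k : ℕ) :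
    ∫⁻ ω, ENNReal.ofReal (Real.cosh ‖θ • rowSum c r h U ξ k ω‖) ∂P
      ≤ ENNReal.ofReal (Real.exp (5 / 4 * (θ ^ 2 * σ ^ 2) *
        ∑ j ∈ Finset.range k, r (j + 1) * c (j + 1) ^ 2)) := by
  induction k with
  | zero => simp [rowSum]
  | succ k ih =>
    have h1 := lintegral_cosh_rowPart_le (c := c) (r := r) hσ hξ hlaw hind hh hmean htail hU θ k
      (r (k + 1))
    have h2 : ∀ ω, rowSum c r h U ξ (k + 1) ω = rowSum c r h U ξ k ω +
        c (k + 1) • ∑ s ∈ Finset.range (r (k + 1)), h (U (k + 1) ω) (ξ (k + 1) s ω) :=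
      fun ω => Finset.sum_range_succ _ _
    simp_rw [h2]
    refine h1.trans ((mul_le_mul_left ih _).trans ?_)
    rw [← ENNReal.ofReal_mul (Real.exp_pos _).le, ← Real.exp_add, Finset.sum_range_succ, mul_add]

/-- Dimension-free large deviation bound for sums of centred light-tailed increments. -/
theorem measure_rowSum_ge_le [CompleteSpace E] [IsProbabilityMeasure P]
    [IsProbabilityMeasure ν]
    (hσ : 0 < σ) (hξ : ∀ k s, Measurable (ξ k s)) (hlaw : ∀ k s, P.map (ξ k s) = ν)
    (hind : iIndepFun (fun p : ℕ × ℕ => ξ p.1 p.2) P)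
    (hh : Measurable (Function.uncurry h)) (hmean : ∀ u, ∫ x, h u x ∂ν = 0)
    (htail : ∀ u, ∫⁻ x, ENNReal.ofReal (Real.exp (‖h u x‖ ^ 2 / σ ^ 2)) ∂ν
      ≤ ENNReal.ofReal (Real.exp 1))
    (hU : ∀ k, Measurable[sigmaOf ξ (rowsUpTo k)] (U (k + 1))) {v l : ℝ} (hv : 0 < v) (hl : 1 ≤ l)
    {k : ℕ} (hk : σ ^ 2 * ∑ j ∈ Finset.range k, r (j + 1) * c (j + 1) ^ 2 ≤ v) :
    P {ω | 10 * l * v < ‖rowSum c r h U ξ k ω‖ ^ 2} ≤ ENNReal.ofReal (Real.exp (-l)) := by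
  set t := √(10 * l * v) with ht
  have ht2 : t ^ 2 = 10 * l * v := Real.sq_sqrt (by positivity)
  have ht0 : 0 < t := Real.sqrt_pos.2 (by positivity)
  -- This `θ` minimizes the Chernoff exponent `5 θ² v / 4 - θ t`. With `t² = 10 l v` the minimum is
  -- `2 l - 4 l = -2 l`; the spare factor `exp (-l)` pays for the `2` lost in `cosh x ≥ exp x / 2`.
  set θ := 2 * t / (5 * v) with hθ
  have hθ0 : 0 < θ := by positivity
  have h1 := lintegral_cosh_rowSum_le (c := c) (r := r) hσ hξ hlaw hind hh hmean htail hU θ k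
  have hmeas : Measurable fun ω => ENNReal.ofReal (Real.cosh ‖θ • rowSum c r h U ξ k ω‖) := by
    have hc : Continuous fun v : E => ENNReal.ofReal (Real.cosh ‖θ • v‖) := ENNReal.continuous_ofReal.comp (by fun_prop)
    exact hc.measurable.comp ((measurable_rowSum hh hU k).mono (sigmaOf_le hξ _) le_rfl)
  have hsub : {ω | 10 * l * v < ‖rowSum c r h U ξ k ω‖ ^ 2} ⊆
      {ω | ENNReal.ofReal (Real.exp (θ * t) / 2) ≤
        ENNReal.ofReal (Real.cosh ‖θ • rowSum c r h U ξ k ω‖)} := fun ω hω => by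
    refine ENNReal.ofReal_le_ofReal ?_
    have h2 : t < ‖rowSum c r h U ξ k ω‖ := by
      refine lt_of_pow_lt_pow_left₀ 2 (norm_nonneg _) ?_
      rw [ht2]; exact hω
    rw [norm_smul, Real.norm_of_nonneg hθ0.le, Real.cosh_eq]
    have h3 : Real.exp (θ * t) ≤ Real.exp (θ * ‖rowSum c r h U ξ k ω‖) := by gcongr
    have h4 := Real.exp_pos (-(θ * ‖rowSum c r h U ξ k ω‖))
    linarith
  have hpos : 0 < Real.exp (θ * t) / 2 := by positivity
  calc P {ω | 10 * l * v < ‖rowSum c r h U ξ k ω‖ ^ 2}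
      ≤ _ := measure_mono hsub
    _ ≤ (∫⁻ ω, ENNReal.ofReal (Real.cosh ‖θ • rowSum c r h U ξ k ω‖) ∂P) /
          ENNReal.ofReal (Real.exp (θ * t) / 2) :=
        meas_ge_le_lintegral_div hmeas.aemeasurable (by simpa using hpos) ENNReal.ofReal_ne_top
    _ ≤ ENNReal.ofReal (Real.exp (5 / 4 * (θ ^ 2 * σ ^ 2) *
        ∑ j ∈ Finset.range k, r (j + 1) * c (j + 1) ^ 2)) /
          ENNReal.ofReal (Real.exp (θ * t) / 2) := ENNReal.div_le_div_right h1 _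
    _ ≤ ENNReal.ofReal (Real.exp (-l)) := by
        rw [← ENNReal.ofReal_div_of_pos hpos]
        refine ENNReal.ofReal_le_ofReal ?_
        have h5 : 5 / 4 * (θ ^ 2 * σ ^ 2) *
            ∑ j ∈ Finset.range k, (r (j + 1) : ℝ) * c (j + 1) ^ 2 ≤ 5 / 4 * θ ^ 2 * v := by
          calc _ = 5 / 4 * θ ^ 2 * (σ ^ 2 *
            ∑ j ∈ Finset.range k, (r (j + 1) : ℝ) * c (j + 1) ^ 2) := by ring
            _ ≤ _ := by gcongr
        have h6 : 5 / 4 * θ ^ 2 * v = 2 * l := by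
          have : 5 / 4 * θ ^ 2 * v = t ^ 2 / (5 * v) := by rw [hθ]; field_simp; norm_num
          rw [this, ht2]; field_simp; norm_num
        have h7 : θ * t = 4 * l := by
          have : θ * t = 2 * t ^ 2 / (5 * v) := by rw [hθ]; field_simp
          rw [this, ht2]; field_simp; norm_num
        rw [div_le_iff₀ hpos, h7, mul_div_assoc', ← Real.exp_add]
        have h8 : (2 : ℝ) ≤ Real.exp 1 := by
          have := Real.add_one_le_exp (1 : ℝ); linarith
        have h9 : Real.exp 1 * Real.exp (2 * l) ≤ Real.exp (-l + 4 * l) := by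
          rw [← Real.exp_add]; exact Real.exp_le_exp.2 (by linarith)
        have h10 := Real.exp_le_exp.2 (h5.trans h6.le)
        have h11 := Real.exp_pos (2 * l)
        nlinarith

end RowSums

/-! ### Gradients, the descent lemma and subgradients -/

section Gradient

variable {E : Type*} [NormedAddCommGroup E] [InnerProductSpace ℝ E] [CompleteSpace E]

theorem hasGradientAt_comp_clm {φ : E → ℝ} {g : E} {A : E →L[ℝ] E}
    (hA : ∀ u v, ⟪A u, v⟫_ℝ = ⟪u, A v⟫_ℝ) {y : E} (h : HasGradientAt φ g (A y)) :
    HasGradientAt (fun z => φ (A z)) (A g) y := by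
  rw [hasGradientAt_iff_hasFDerivAt] at h ⊢
  have h1 := h.comp y A.hasFDerivAt
  have h2 : InnerProductSpace.toDual ℝ E (A g) = (InnerProductSpace.toDual ℝ E g).comp A := by
    ext v
    simp [hA]
  rw [h2]
  exact h1

/-- The descent lemma for functions with Lipschitz gradient. -/
theorem le_add_inner_add_of_lipschitz_gradient {f : E → ℝ} {g : E → E} {L : ℝ}
    (hf : ∀ x, HasGradientAt f (g x) x) (hL : ∀ y z, ‖g y - g z‖ ≤ L * ‖y - z‖) (x y : E) :
    f y ≤ f x + ⟪g x, y - x⟫_ℝ + L / 2 * ‖y - x‖ ^ 2 := by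
  set d := y - x with hd
  -- The gap to the quadratic model along the segment from `x` to `y`. Its derivative is nonpositive
  -- by the Lipschitz bound, and `q 1 ≤ q 0` is the claim.
  set q : ℝ → ℝ := fun t => f (x + t • d) - t * ⟪g x, d⟫_ℝ - L / 2 * ‖d‖ ^ 2 * t ^ 2 with hq
  have hderiv : ∀ t, HasDerivAt q (⟪g (x + t • d), d⟫_ℝ - ⟪g x, d⟫_ℝ - L * ‖d‖ ^ 2 * t) t := by
    intro t
    have h1 : HasDerivAt (fun t : ℝ => x + t • d) d t := by
      simpa using ((hasDerivAt_id t).smul_const d).const_add x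
    have h2 : HasDerivAt (fun t : ℝ => f (x + t • d)) ⟪g (x + t • d), d⟫_ℝ t := by
      have := (hf (x + t • d)).hasFDerivAt.comp_hasDerivAt t h1
      simpa using! this
    have h3 : HasDerivAt (fun t : ℝ => t * ⟪g x, d⟫_ℝ) ⟪g x, d⟫_ℝ t := by
      simpa using (hasDerivAt_id t).mul_const ⟪g x, d⟫_ℝ
    have h4 : HasDerivAt (fun t : ℝ => L / 2 * ‖d‖ ^ 2 * t ^ 2) (L * ‖d‖ ^ 2 * t) t := by
      have := (hasDerivAt_pow 2 t).const_mul (L / 2 * ‖d‖ ^ 2)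
      refine this.congr_deriv ?_
      push_cast; ring
    exact (h2.sub h3).sub h4
  have hanti : AntitoneOn q (Set.Icc 0 1) := by
    refine antitoneOn_of_deriv_nonpos (convex_Icc 0 1)
      (fun t _ => (hderiv t).continuousAt.continuousWithinAt)
      (fun t _ => (hderiv t).differentiableAt.differentiableWithinAt) fun t ht => ?_
    rw [interior_Icc] at ht
    rw [(hderiv t).deriv, ← inner_sub_left]
    have h5 := real_inner_le_norm (g (x + t • d) - g x) d
    have h6 := hL (x + t • d) x
    rw [add_sub_cancel_left, norm_smul, Real.norm_of_nonneg ht.1.le] at h6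
    have h7 := mul_le_mul_of_nonneg_right h6 (norm_nonneg d)
    nlinarith
  have h := hanti (Set.left_mem_Icc.2 zero_le_one) (Set.right_mem_Icc.2 zero_le_one) zero_le_one
  simp only [hq, one_smul, zero_smul, add_zero, one_mul, zero_mul, one_pow, mul_one, sub_zero,
    ne_eq, OfNat.ofNat_ne_zero, not_false_eq_true, zero_pow, mul_zero] at h
  rw [hd, add_sub_cancel] at h
  rw [hd]
  linarith

theorem hasGradientAt_of_quadratic_bounds {f : E → ℝ} {g y : E} {K : ℝ} (hK : 0 < K)
    (h0 : ∀ z, 0 ≤ f z - f y - ⟪g, z - y⟫_ℝ) (h1 : ∀ z, f z - f y - ⟪g, z - y⟫_ℝ ≤ K * ‖z - y‖ ^ 2) :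
    HasGradientAt f g y := by
  rw [hasGradientAt_iff_isLittleO, Asymptotics.isLittleO_iff]
  intro c hc
  filter_upwards [Metric.ball_mem_nhds y (div_pos hc hK)] with z hz
  rw [Real.norm_of_nonneg (h0 z)]
  rw [Metric.mem_ball, dist_eq_norm, lt_div_iff₀ hK] at hz
  refine (h1 z).trans ?_
  nlinarith [norm_nonneg (z - y)]

/-- A subgradient on the whole space is the gradient. -/
theorem eq_gradient_of_subgradient {f : E → ℝ} {g x y : E} (hf : HasGradientAt f g y)
    (hx : ∀ z, f y + ⟪x, z - y⟫_ℝ ≤ f z) : x = g := by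
  have hmin : IsLocalMin (fun z => f z - ⟪x, z⟫_ℝ) y := by
    refine Filter.Eventually.of_forall fun z => ?_
    have := hx z
    rw [inner_sub_right] at this
    simp only
    linarith
  have hd : HasFDerivAt (fun z => f z - ⟪x, z⟫_ℝ) (InnerProductSpace.toDual ℝ E g -
      InnerProductSpace.toDual ℝ E x) y :=
    hf.hasFDerivAt.sub (InnerProductSpace.toDual ℝ E x).hasFDerivAt
  have := hmin.hasFDerivAt_eq_zero hd
  rw [← map_sub, map_eq_zero_iff _ (InnerProductSpace.toDual ℝ E).injective, sub_eq_zero] at this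
  exact this.symm

end Gradient

/-! ### Minimizers of strongly convex functions -/

section StrongConvexity

variable {E : Type*} [NormedAddCommGroup E] [InnerProductSpace ℝ E]

theorem strongConvexOn_sub_inner {F : E → ℝ} {μ : ℝ} (hF : StrongConvexOn Set.univ μ F) (y : E) :
    StrongConvexOn Set.univ μ fun x => F x - ⟪y, x⟫_ℝ := by
  rw [strongConvexOn_iff_convex] at hF ⊢
  have h : ConvexOn ℝ Set.univ fun x : E => -⟪y, x⟫_ℝ := by
    refine ⟨convex_univ, fun u _ v _ a b _ _ _ => ?_⟩
    simp only [inner_add_right, inner_smul_right, smul_eq_mul]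
    linarith
  refine (hF.add h).congr fun x _ => ?_
  simp only [Pi.add_apply]
  ring

/-- On the segment from `p` to `x`, strong convexity and minimality at `p` give an inequality with a
common factor `t`; cancel it and let `t` tend to `0`. -/
theorem StrongConvexOn.add_sq_le_of_isMinOn {g : E → ℝ} {μ : ℝ}
    (hg : StrongConvexOn Set.univ μ g) {p : E} (hp : IsMinOn g Set.univ p) (x : E) :
    g p + μ / 2 * ‖x - p‖ ^ 2 ≤ g x := by
  have key : ∀ t ∈ Set.Ioo (0 : ℝ) 1, (1 - t) * (μ / 2 * ‖x - p‖ ^ 2) ≤ g x - g p := by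
    intro t ht
    have h1 := hg.2 (Set.mem_univ x) (Set.mem_univ p) ht.1.le (sub_nonneg.2 ht.2.le) (by ring)
    have h2 : g p ≤ g (t • x + (1 - t) • p) := hp (Set.mem_univ _)
    simp only [smul_eq_mul] at h1
    have h3 : t * ((1 - t) * (μ / 2 * ‖x - p‖ ^ 2)) ≤ t * (g x - g p) := by linarith
    exact le_of_mul_le_mul_left h3 ht.1
  have hlim : Filter.Tendsto (fun t : ℝ => (1 - t) * (μ / 2 * ‖x - p‖ ^ 2)) (nhdsWithin 0 (Set.Ioi 0))
      (nhds ((1 - 0) * (μ / 2 * ‖x - p‖ ^ 2))) :=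
    ((by fun_prop : Continuous fun t : ℝ => (1 - t) * (μ / 2 * ‖x - p‖ ^ 2)).tendsto 0).mono_left
      nhdsWithin_le_nhds
  have := le_of_tendsto hlim (Filter.eventually_of_mem (Ioo_mem_nhdsGT one_pos) key)
  linarith

theorem StrongConvexOn.continuous [FiniteDimensional ℝ E] {g : E → ℝ} {μ : ℝ} (hμ : 0 < μ)
    (hg : StrongConvexOn Set.univ μ g) : Continuous g := by
  have : ConvexOn ℝ Set.univ g := hg.convexOn fun r => by positivity
  exact this.locallyLipschitz.continuous

theorem StrongConvexOn.exists_isMinOn [FiniteDimensional ℝ E] {g : E → ℝ} {μ : ℝ} (hμ : 0 < μ)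
    (hg : StrongConvexOn Set.univ μ g) : ∃ p, IsMinOn g Set.univ p := by
  have hc := StrongConvexOn.continuous hμ hg
  have : ProperSpace E := FiniteDimensional.proper_real E
  obtain ⟨x₀, -, hx₀⟩ := (isCompact_closedBall (0 : E) 1).exists_isMinOn
    ⟨0, Metric.mem_closedBall_self zero_le_one⟩ hc.continuousOn
  have h00 : g x₀ ≤ g 0 := hx₀ (Metric.mem_closedBall_self zero_le_one)
  -- Beyond this radius `g x ≥ g 0`: apply strong convexity on the segment from `0` to `x` at its
  -- point of norm `1`, where `g` is at least `g x₀`. A minimizer over the ball of radius `R` is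
  -- thus a global one.
  set R := 1 + (g 0 - g x₀) * (2 / μ) with hR
  have hR1 : 1 ≤ R := by
    have : 0 ≤ (g 0 - g x₀) * (2 / μ) := mul_nonneg (by linarith) (by positivity)
    linarith
  obtain ⟨p, -, hp⟩ := (isCompact_closedBall (0 : E) R).exists_isMinOn
    ⟨0, Metric.mem_closedBall_self (by linarith)⟩ hc.continuousOn
  refine ⟨p, fun x _ => ?_⟩
  rcases le_or_gt ‖x‖ R with hx | hx
  · exact hp (mem_closedBall_zero_iff.2 hx)
  have hp0 : g p ≤ g 0 := hp (Metric.mem_closedBall_self (by linarith))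
  refine hp0.trans ?_
  have hx1 : 1 < ‖x‖ := by linarith
  have hx0 : 0 < ‖x‖ := by linarith
  have ht1 : ‖x‖⁻¹ ≤ 1 := inv_le_one_of_one_le₀ hx1.le
  have h1 := hg.2 (Set.mem_univ x) (Set.mem_univ (0 : E)) (inv_nonneg.2 hx0.le)
    (sub_nonneg.2 ht1) (by ring)
  have h2 : g x₀ ≤ g (‖x‖⁻¹ • x + (1 - ‖x‖⁻¹) • (0 : E)) := by
    refine hx₀ (mem_closedBall_zero_iff.2 ?_)
    rw [smul_zero, add_zero, norm_smul, norm_inv, norm_norm, inv_mul_cancel₀ hx0.ne']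
  simp only [smul_eq_mul, sub_zero] at h1
  have h3 := mul_le_mul_of_nonneg_left (h2.trans h1) hx0.le
  have h4 : ‖x‖ * (‖x‖⁻¹ * g x + (1 - ‖x‖⁻¹) * g 0 - ‖x‖⁻¹ * (1 - ‖x‖⁻¹) * (μ / 2 * ‖x‖ ^ 2)) =
      g x + (‖x‖ - 1) * g 0 - (‖x‖ - 1) * (μ / 2 * ‖x‖) := by
    field_simp
  rw [h4] at h3
  have h5 : g 0 - g x₀ ≤ (‖x‖ - 1) * (μ / 2) := by
    have : (g 0 - g x₀) * (2 / μ) ≤ ‖x‖ - 1 := by linarith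
    calc g 0 - g x₀ = (g 0 - g x₀) * (2 / μ) * (μ / 2) := by field_simp
      _ ≤ _ := by gcongr
  nlinarith

end StrongConvexity

/-! ### The conjugate function and its gradient -/

section Conjugate

variable {m n : ℕ} {F : Stacked m n → ℝ} {μ : ℝ}

theorem isMaxOn_primalPoint (hμ : 0 < μ) (hF : StrongConvexOn Set.univ μ F) (y : Stacked m n) :
    IsMaxOn (fun x => ⟪y, x⟫_ℝ - F x) Set.univ (primalPoint F y) := by
  obtain ⟨p, hp⟩ := StrongConvexOn.exists_isMinOn hμ (strongConvexOn_sub_inner hF y)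
  refine Classical.epsilon_spec (p := fun x => IsMaxOn (fun x => ⟪y, x⟫_ℝ - F x) Set.univ x)
    ⟨p, fun x hx => ?_⟩
  have h : F p - ⟪y, p⟫_ℝ ≤ F x - ⟪y, x⟫_ℝ := hp hx
  change ⟪y, x⟫_ℝ - F x ≤ ⟪y, p⟫_ℝ - F p
  linarith

theorem conj_eq (hμ : 0 < μ) (hF : StrongConvexOn Set.univ μ F) (y : Stacked m n) :
    conj F y = ⟪y, primalPoint F y⟫_ℝ - F (primalPoint F y) := by
  have h := isMaxOn_primalPoint hμ hF y
  refine IsGreatest.csSup_eq ⟨⟨_, rfl⟩, ?_⟩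
  rintro _ ⟨x, rfl⟩
  exact h (Set.mem_univ x)

theorem inner_sub_add_sq_le_conj (hμ : 0 < μ) (hF : StrongConvexOn Set.univ μ F)
    (y x : Stacked m n) :
    ⟪y, x⟫_ℝ - F x + μ / 2 * ‖x - primalPoint F y‖ ^ 2 ≤ conj F y := by
  have h := isMaxOn_primalPoint hμ hF y
  have h2 := StrongConvexOn.add_sq_le_of_isMinOn (strongConvexOn_sub_inner hF y)
    (p := primalPoint F y) (fun z hz => ?_) x
  · rw [conj_eq hμ hF]; linarith
  · have h3 : ⟪y, z⟫_ℝ - F z ≤ ⟪y, primalPoint F y⟫_ℝ - F (primalPoint F y) := h hz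
    change F (primalPoint F y) - ⟪y, primalPoint F y⟫_ℝ ≤ F z - ⟪y, z⟫_ℝ
    linarith

theorem inner_sub_le_conj (hμ : 0 < μ) (hF : StrongConvexOn Set.univ μ F) (y x : Stacked m n) :
    ⟪y, x⟫_ℝ - F x ≤ conj F y := by
  have := inner_sub_add_sq_le_conj hμ hF y x
  have h2 : 0 ≤ μ / 2 * ‖x - primalPoint F y‖ ^ 2 := by positivity
  linarith

/-- Add the quadratic growth inequalities at `y` and at `z`, each tested at the maximizer of the
other; Cauchy-Schwarz leaves one factor of the distance to cancel. -/
theorem norm_primalPoint_sub_le (hμ : 0 < μ) (hF : StrongConvexOn Set.univ μ F)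
    (y z : Stacked m n) : ‖primalPoint F y - primalPoint F z‖ ≤ ‖y - z‖ / μ := by
  have h1 := inner_sub_add_sq_le_conj hμ hF y (primalPoint F z)
  have h2 := inner_sub_add_sq_le_conj hμ hF z (primalPoint F y)
  rw [conj_eq hμ hF] at h1 h2
  rw [norm_sub_rev] at h1
  have h3 := real_inner_le_norm (y - z) (primalPoint F y - primalPoint F z)
  have h4 : ⟪y - z, primalPoint F y - primalPoint F z⟫_ℝ = ⟪y, primalPoint F y⟫_ℝ
      - ⟪y, primalPoint F z⟫_ℝ - ⟪z, primalPoint F y⟫_ℝ + ⟪z, primalPoint F z⟫_ℝ := by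
    simp only [inner_sub_left, inner_sub_right]; ring
  rw [le_div_iff₀ hμ]
  rcases (norm_nonneg (primalPoint F y - primalPoint F z)).eq_or_lt with h0 | h0
  · rw [← h0, zero_mul]; exact norm_nonneg _
  · refine le_of_mul_le_mul_right ?_ h0
    nlinarith

/-- Testing `conj F z` at the maximizer for `y` bounds the linearization error below by `0`. Testing
`conj F y` at the maximizer for `z` bounds it above by a quadratic, since the maximizers are `1 /
μ`-Lipschitz in `y`. -/
theorem hasGradientAt_conj (hμ : 0 < μ) (hF : StrongConvexOn Set.univ μ F) (y : Stacked m n) :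
    HasGradientAt (conj F) (primalPoint F y) y := by
  refine hasGradientAt_of_quadratic_bounds (K := 1 / μ) (by positivity) (fun z => ?_) fun z => ?_
  · have := inner_sub_le_conj hμ hF z (primalPoint F y)
    have h7 := real_inner_comm (z - y) (primalPoint F y)
    rw [inner_sub_left] at h7
    rw [conj_eq hμ hF y]
    linarith
  · have h1 := inner_sub_le_conj hμ hF y (primalPoint F z)
    have h2 := real_inner_le_norm (z - y) (primalPoint F z - primalPoint F y)
    have h3 := norm_primalPoint_sub_le hμ hF z y
    have h4 : ‖z - y‖ * ‖primalPoint F z - primalPoint F y‖ ≤ ‖z - y‖ * (‖z - y‖ / μ) := by gcongr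
    have h5 : ‖z - y‖ * (‖z - y‖ / μ) = 1 / μ * ‖z - y‖ ^ 2 := by ring
    have h6 := conj_eq hμ hF z
    have h7 := real_inner_comm (z - y) (primalPoint F y)
    rw [inner_sub_right] at h2
    rw [inner_sub_left] at h2 
    linarith

end Conjugate

/-! ### Spectral facts about the communication matrix -/

section Network

variable {m n : ℕ} {W : Matrix (Fin m × Fin n) (Fin m × Fin n) ℝ}

theorem sqrtOp_inner_left (W : Matrix (Fin m × Fin n) (Fin m × Fin n) ℝ) (u v : Stacked m n) :
    ⟪sqrtOp W u, v⟫_ℝ = ⟪u, sqrtOp W v⟫_ℝ := by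
  have h : IsSelfAdjoint (CFC.sqrt W) := IsSelfAdjoint.of_nonneg (CFC.sqrt_nonneg W)
  have h2 : IsSelfAdjoint (sqrtOp W) := h.map (Matrix.toEuclideanCLM (𝕜 := ℝ))
  rw [ContinuousLinearMap.isSelfAdjoint_iff'] at h2
  conv_lhs => rw [← h2]
  exact ContinuousLinearMap.adjoint_inner_left _ _ _

theorem norm_sqrtOp_sq (hW : W.PosSemidef) (v : Stacked m n) :
    ‖sqrtOp W v‖ ^ 2 = v.ofLp ⬝ᵥ W.mulVec v.ofLp := by
  rw [← real_inner_self_eq_norm_sq, sqrtOp_inner_left]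
  have h : CFC.sqrt W * CFC.sqrt W = W := CFC.sqrt_mul_sqrt_self W hW.nonneg
  have h2 : sqrtOp W (sqrtOp W v) = Matrix.toEuclideanCLM (𝕜 := ℝ) W v := by
    conv_rhs => rw [← h, map_mul]
    rfl
  rw [h2, EuclideanSpace.inner_eq_star_dotProduct]
  simp [dotProduct_comm]

theorem le_lamMax {t : ℝ} (ht : t ∈ spectrum ℝ W) : t ≤ lamMax W :=
  le_csSup (Matrix.finite_spectrum W).bddAbove ht

theorem norm_sqrtOp_sq_le (hW : W.PosSemidef) (v : Stacked m n) :
    ‖sqrtOp W v‖ ^ 2 ≤ lamMax W * ‖v‖ ^ 2 := by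
  have h : W ≤ algebraMap ℝ _ (lamMax W) :=
    le_algebraMap_of_spectrum_le (fun x hx => le_lamMax hx) hW.isHermitian
  have h2 := (Matrix.le_iff.1 h).dotProduct_mulVec_nonneg v.ofLp
  rw [norm_sqrtOp_sq hW, ← real_inner_self_eq_norm_sq, EuclideanSpace.inner_eq_star_dotProduct]
  simp only [Matrix.sub_mulVec, Algebra.algebraMap_eq_smul_one, Matrix.smul_mulVec, Matrix.one_mulVec,
    dotProduct_sub, dotProduct_smul, star_trivial, smul_eq_mul] at h2 ⊢
  linarith

theorem norm_sqrtOp_le (hW : W.PosSemidef) (v : Stacked m n) :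
    ‖sqrtOp W v‖ ≤ √(lamMax W) * ‖v‖ := by
  rw [← Real.sqrt_sq (norm_nonneg v), ← Real.sqrt_mul' _ (sq_nonneg _)]
  exact Real.le_sqrt_of_sq_le (norm_sqrtOp_sq_le hW v)

/-- The largest eigenvalue is itself a positive eigenvalue, so the infimum runs over a nonempty
finite set and is attained. -/
theorem lamMinPos_pos (h : 0 < lamMax W) : 0 < lamMinPos W := by
  have hfin := Matrix.finite_spectrum W
  have hne : (spectrum ℝ W).Nonempty := by
    by_contra hne
    rw [Set.not_nonempty_iff_eq_empty] at hne
    rw [lamMax, hne, Real.sSup_empty] at h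
    exact h.false
  have hmem : lamMax W ∈ spectrum ℝ W := hne.csSup_mem hfin
  have : lamMinPos W ∈ {t ∈ spectrum ℝ W | 0 < t} :=
    Set.Nonempty.csInf_mem ⟨_, hmem, h⟩ (hfin.subset fun t ht => ht.1)
  exact this.2

variable {G : SimpleGraph (Fin m)} [DecidableRel G.Adj]

theorem posSemidef_commMatrix : (commMatrix n G).PosSemidef :=
  (SimpleGraph.posSemidef_lapMatrix ℝ G).kronecker Matrix.PosSemidef.one

theorem commMatrix_mulVec (x : Stacked m n) (i : Fin m) (j : Fin n) :
    (commMatrix n G).mulVec x.ofLp (i, j) = (G.lapMatrix ℝ).mulVec (fun i => x (i, j)) i := by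
  simp [commMatrix, Matrix.mulVec, dotProduct, Fintype.sum_prod_type, Matrix.kroneckerMap_apply,
    Matrix.one_apply]

/-- The kernel of `√W` is the consensus subspace. -/
theorem sqrtOp_eq_zero_iff (hG : G.Connected) (x : Stacked m n) :
    sqrtOp (commMatrix n G) x = 0 ↔ x ∈ consensus m n := by
  have h1 : sqrtOp (commMatrix n G) x = 0 ↔ (commMatrix n G).mulVec x.ofLp = 0 := by
    rw [← posSemidef_commMatrix.dotProduct_mulVec_zero_iff, star_trivial,
      ← norm_sqrtOp_sq posSemidef_commMatrix]
    simp
  have h2 : (commMatrix n G).mulVec x.ofLp = 0 ↔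
      ∀ j, (G.lapMatrix ℝ).mulVec (fun i => x (i, j)) = 0 := by
    constructor
    · intro h j
      funext i
      rw [← commMatrix_mulVec, h]; rfl
    · intro h
      funext ⟨i, j⟩
      rw [commMatrix_mulVec, h]; rfl
  rw [h1, h2]
  simp only [SimpleGraph.lapMatrix_mulVec_eq_zero_iff_forall_reachable]
  constructor
  · intro h i i'
    ext j
    exact h j i i' (hG.preconnected i i')
  · intro h j i i' _
    exact congrArg (fun v : EuclideanSpace ℝ (Fin n) => v j) (h i i')

end Network

/-- The gradient of a function that is differentiable in a vector and measurable in a parameter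
is jointly measurable. -/
theorem measurable_uncurry_of_hasGradientAt {E Ξ : Type*} [NormedAddCommGroup E]
    [InnerProductSpace ℝ E] [FiniteDimensional ℝ E] [MeasurableSpace E] [BorelSpace E]
    [MeasurableSpace Ξ] {φ : E → Ξ → ℝ} {g : E → Ξ → E} (hφ : ∀ y, Measurable (φ y))
    (hg : ∀ y ξ, HasGradientAt (fun z => φ z ξ) (g y ξ) y) : Measurable (Function.uncurry g) := by
  have : CompleteSpace E := FiniteDimensional.complete ℝ E
  have : ProperSpace E := FiniteDimensional.proper_real E
  have hu : Measurable (Function.uncurry φ) :=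
    measurable_uncurry_of_continuous_of_measurable
      (fun ξ => continuous_iff_continuousAt.2 fun y => (hg y ξ).continuousAt) hφ
  -- Each directional derivative is a limit of difference quotients of the jointly measurable `φ`;
  -- an orthonormal basis then reassembles the gradient.
  have hdir : ∀ v : E, Measurable fun p : E × Ξ => ⟪g p.1 p.2, v⟫_ℝ := fun v => by
    refine measurable_of_tendsto_metrizable (f := fun (n : ℕ) (p : E × Ξ) =>
      ((n : ℝ) + 1) * (φ (p.1 + ((n : ℝ) + 1)⁻¹ • v) p.2 - φ p.1 p.2)) (fun n => ?_) ?_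
    · refine measurable_const.mul (Measurable.sub ?_ hu)
      exact hu.comp ((measurable_fst.add_const _).prodMk measurable_snd)
    · refine tendsto_pi_nhds.2 fun p => ?_
      have h := (hg p.1 p.2).hasFDerivAt.hasLineDerivAt v
      have h2 := h.tendsto_slope_zero.comp (f := fun n : ℕ => ((n : ℝ) + 1)⁻¹)
        (y := nhdsWithin 0 {0}ᶜ) (x := Filter.atTop)
        (tendsto_nhdsWithin_iff.2 ⟨by
          simpa [one_div] using tendsto_one_div_add_atTop_nhds_zero_nat (𝕜 := ℝ),
          Filter.Eventually.of_forall fun n => by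
            simp only [Set.mem_compl_iff, Set.mem_singleton_iff]; positivity⟩)
      refine Filter.Tendsto.congr (fun n => ?_) (by simpa using! h2)
      simp
  set b := stdOrthonormalBasis ℝ E
  have hsum : Function.uncurry g = fun p : E × Ξ => ∑ i, ⟪g p.1 p.2, b i⟫_ℝ • b i := by
    funext p
    have := b.sum_repr' (g p.1 p.2)
    simp_rw [real_inner_comm (g p.1 p.2)] at this ⊢
    exact this.symm
  rw [hsum]
  exact Finset.measurable_fun_sum _ fun i _ => (hdir (b i)).smul_const _

/-! ### Unbiasedness and measurability of the stochastic oracle -/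

section OracleProperties

theorem integrable_of_sub_const {Ξ E : Type*} [MeasurableSpace Ξ] [NormedAddCommGroup E]
    {ν : Measure Ξ} [IsFiniteMeasure ν] {X : Ξ → E} {c : E}
    (h : Integrable (fun ξ => X ξ - c) ν) : Integrable X ν :=
  (h.add (integrable_const c)).congr (ae_of_all _ fun ξ => sub_add_cancel (X ξ) c)

/-- The mean of integrable subgradients is the gradient of the mean. -/
theorem integral_eq_gradient {Ξ E : Type*} [MeasurableSpace Ξ] [NormedAddCommGroup E]
    [InnerProductSpace ℝ E] [CompleteSpace E] {ν : Measure Ξ} {φ : E → Ξ → ℝ} {X : Ξ → E} {y g : E}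
    (hX : Integrable X ν) (hφ : ∀ z, Integrable (φ z) ν)
    (hle : ∀ z ξ, φ y ξ + ⟪X ξ, z - y⟫_ℝ ≤ φ z ξ)
    (hg : HasGradientAt (fun z => ∫ ξ, φ z ξ ∂ν) g y) : ∫ ξ, X ξ ∂ν = g := by
  refine eq_gradient_of_subgradient hg fun z => ?_
  have h1 : Integrable (fun ξ => ⟪X ξ, z - y⟫_ℝ) ν := hX.inner_const _
  have h2 : ∫ ξ, (φ y ξ + ⟪X ξ, z - y⟫_ℝ) ∂ν ≤ ∫ ξ, φ z ξ ∂ν :=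
    integral_mono ((hφ y).add h1) (hφ z) (hle z)
  rw [integral_add (hφ y) h1] at h2
  simp_rw [real_inner_comm (z - y)] at h2
  rwa [integral_inner hX, real_inner_comm] at h2

variable {m n : ℕ} {Ξ : Type*} [MeasurableSpace Ξ] {ν : Measure Ξ} {F : Stacked m n → ℝ}
  {μ σ : ℝ}

/-- The maximizer for `y` is a competitor in the problem defining `φ(z, ξ)`. -/
theorem StochasticDual.phi_add_inner_le (S : StochasticDual ν F) (y z : Stacked m n) (ξ : Ξ) :
    S.phi y ξ + ⟪S.point y ξ, z - y⟫_ℝ ≤ S.phi z ξ := by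
  obtain ⟨⟨x, hx⟩, hmax⟩ := S.isGreatest_phi y ξ
  have hp : IsMaxOn (fun x => ((⟪y, x⟫_ℝ : ℝ) : EReal) - S.primal x ξ) Set.univ (S.point y ξ) :=
    Classical.epsilon_spec
      (p := fun x => IsMaxOn (fun x => ((⟪y, x⟫_ℝ : ℝ) : EReal) - S.primal x ξ) Set.univ x)
      ⟨x, fun x' _ => by
        change _ ≤ ((⟪y, x⟫_ℝ : ℝ) : EReal) - S.primal x ξ
        exact (hmax ⟨x', rfl⟩).trans hx.ge⟩
  have heq : ((⟪y, S.point y ξ⟫_ℝ : ℝ) : EReal) - S.primal (S.point y ξ) ξ = S.phi y ξ := by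
    refine le_antisymm (hmax ⟨_, rfl⟩) ?_
    rw [← hx]
    exact hp (Set.mem_univ x)
  have hz := (S.isGreatest_phi z ξ).2 ⟨S.point y ξ, rfl⟩
  simp only at hz
  -- The maximum `φ(y, ξ)` is a real number, so `F(·, ξ)` is finite at the maximizer and the
  -- comparison takes place in `ℝ`.
  generalize S.primal (S.point y ξ) ξ = t at heq hz
  induction t using EReal.rec with
  | bot => simp at heq
  | top => simp at heq
  | coe a =>
    rw [← EReal.coe_sub, EReal.coe_eq_coe_iff] at heq
    rw [← EReal.coe_sub, EReal.coe_le_coe_iff] at hz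
    have h7 := real_inner_comm (z - y) (S.point y ξ)
    rw [inner_sub_left] at h7
    rw [← heq]
    linarith

theorem StochasticDual.hasGradientAt_phi (S : StochasticDual ν F) (y : Stacked m n) (ξ : Ξ) :
    HasGradientAt (fun z => S.phi z ξ) (S.point y ξ) y := by
  have h := (S.differentiable_phi ξ y).hasGradientAt
  rwa [← eq_gradient_of_subgradient h fun z => S.phi_add_inner_le y z ξ] at h

/-- The point is selected by choice, but it equals the gradient of the differentiable function `φ(·,
ξ)`, which leaves no freedom and makes it measurable. -/
theorem StochasticDual.measurable_point (S : StochasticDual ν F) :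
    Measurable (Function.uncurry S.point) :=
  measurable_uncurry_of_hasGradientAt S.measurable_phi S.hasGradientAt_phi

theorem StochasticDual.gradPsi_eq (S : StochasticDual ν F)
    (W : Matrix (Fin m × Fin n) (Fin m × Fin n) ℝ) (y : Stacked m n) (ξ : Ξ) :
    S.gradPsi W y ξ = sqrtOp W (S.point (sqrtOp W y) ξ) :=
  (hasGradientAt_comp_clm (sqrtOp_inner_left W) (S.hasGradientAt_phi (sqrtOp W y) ξ)).gradient

theorem hasGradientAt_dualObj (hμ : 0 < μ) (hF : StrongConvexOn Set.univ μ F)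
    (W : Matrix (Fin m × Fin n) (Fin m × Fin n) ℝ) (y : Stacked m n) :
    HasGradientAt (dualObj W F) (sqrtOp W (primalPoint F (sqrtOp W y))) y :=
  hasGradientAt_comp_clm (sqrtOp_inner_left W) (hasGradientAt_conj hμ hF (sqrtOp W y))

theorem continuous_primalPoint (hμ : 0 < μ) (hF : StrongConvexOn Set.univ μ F) :
    Continuous (primalPoint F) := by
  refine (LipschitzWith.of_dist_le_mul (K := (1 / μ).toNNReal) fun y z => ?_).continuous
  rw [dist_eq_norm, dist_eq_norm, Real.coe_toNNReal _ (by positivity)]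
  refine (norm_primalPoint_sub_le hμ hF y z).trans (le_of_eq (by ring))

/-- The noise of the oracle. -/
def StochasticDual.noise (S : StochasticDual ν F) (y : Stacked m n) (ξ : Ξ) : Stacked m n :=
  S.point y ξ - primalPoint F y

theorem StochasticDual.measurable_noise (S : StochasticDual ν F) (hμ : 0 < μ)
    (hF : StrongConvexOn Set.univ μ F) : Measurable (Function.uncurry S.noise) :=
  S.measurable_point.sub ((continuous_primalPoint hμ hF).measurable.comp measurable_fst)

/-- The light tail supplies integrability; `integral_eq_gradient` then gives the mean without
differentiating under the integral. -/
theorem StochasticDual.integral_noise [IsProbabilityMeasure ν] (S : StochasticDual ν F)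
    (hμ : 0 < μ) (hF : StrongConvexOn Set.univ μ F) (hσ : 0 < σ) (hS : S.LightTail σ)
    (y : Stacked m n) : Integrable (S.noise y) ν ∧ ∫ ξ, S.noise y ξ ∂ν = 0 := by
  have hm : Measurable (S.noise y) :=
    (S.measurable_noise hμ hF).of_uncurry_left
  have hi : Integrable (S.noise y) ν :=
    (integrable_of_lightTail hσ hm.aestronglyMeasurable (hS y)).2.2
  have hp : Integrable (S.point y) ν := integrable_of_sub_const hi
  refine ⟨hi, ?_⟩
  have hmean : ∫ ξ, S.point y ξ ∂ν = primalPoint F y := by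
    refine integral_eq_gradient hp S.integrable_phi (S.phi_add_inner_le y) ?_
    simp_rw [S.integral_phi]
    exact hasGradientAt_conj hμ hF y
  exact (integral_sub hp (integrable_const _)).trans (by simp [hmean])

end OracleProperties

/-! ### Growth of the step sizes -/

section Coefficients

variable {L : ℝ}

theorem bigA_succ (L : ℝ) (k : ℕ) : bigA L (k + 1) = bigA L k + alpha L (k + 1) := rfl

theorem alpha_succ_pos (hL : 0 < L) (k : ℕ) : 0 < alpha L (k + 1) := by
  have h : alpha L (k + 1) = (1 + √(1 + 8 * L * bigA L k)) / (4 * L) := rfl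
  rw [h]
  positivity

theorem bigA_succ_pos (hL : 0 < L) (k : ℕ) : 0 < bigA L (k + 1) := by
  rw [bigA_succ]
  exact add_pos_of_nonneg_of_pos (bigA_nonneg hL k) (alpha_succ_pos hL k)

theorem bigA_zero : bigA L 0 = 0 := rfl

theorem bigA_eq_sum (L : ℝ) (k : ℕ) : bigA L k = ∑ j ∈ Finset.range k, alpha L (j + 1) := by
  induction k with
  | zero => simp [bigA_zero]
  | succ k ih => rw [Finset.sum_range_succ, ← ih, bigA_succ]

theorem bigA_eq (hL : 0 < L) : ∀ k, bigA L k = 2 * L * alpha L k ^ 2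
  | 0 => by simp [bigA, alpha, coeffs]
  | k + 1 => (coeffs_spec hL k).2

/-- With `a = α_k` and `b = α_{k+1}`, the recursion reads `2 L (b - a) (b + a) = b`. As `b ≤ a + b ≤
2 b`, each increment lies between `1 / (4 L)` and `1 / (2 L)`. -/
theorem alpha_bounds (hL : 0 < L) (k : ℕ) : k ≤ 4 * L * alpha L k ∧ 2 * L * alpha L k ≤ k := by
  induction k with
  | zero => simp [alpha, coeffs]
  | succ k ih =>
    have h1 := bigA_succ L k
    rw [bigA_eq hL, bigA_eq hL] at h1
    have h2 := alpha_succ_pos hL k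
    have h0 : 0 ≤ alpha L k := by
      have : 0 ≤ 4 * L * alpha L k := (Nat.cast_nonneg k).trans ih.1
      exact nonneg_of_mul_nonneg_right this (by positivity)
    generalize alpha L (k + 1) = b at h1 h2
    generalize alpha L k = a at h0 h1 ih
    have h3 : a ≤ b := by
      by_contra! h
      nlinarith [mul_pos hL h2, mul_nonneg hL.le h0]
    have h4 : 1 ≤ 4 * L * (b - a) := by
      refine le_of_mul_le_mul_right ?_ h2
      nlinarith [mul_nonneg hL.le (sub_nonneg.2 h3), mul_nonneg (mul_nonneg hL.le (sub_nonneg.2 h3))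
        (sub_nonneg.2 h3)]
    have h5 : 2 * L * (b - a) ≤ 1 := by
      refine le_of_mul_le_mul_right ?_ h2
      nlinarith [mul_nonneg (mul_nonneg hL.le (sub_nonneg.2 h3)) h0]
    push_cast
    constructor <;> linarith [ih.1, ih.2]

theorem le_bigA (hL : 0 < L) (k : ℕ) : (k : ℝ) ^ 2 / (8 * L) ≤ bigA L k := by
  rw [bigA_eq hL, div_le_iff₀ (by positivity)]
  have := pow_le_pow_left₀ (Nat.cast_nonneg k) (alpha_bounds hL k).1 2
  linarith

theorem bigA_le (hL : 0 < L) (k : ℕ) : bigA L k ≤ (k : ℝ) ^ 2 / (2 * L) := by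
  rw [bigA_eq hL, le_div_iff₀ (by positivity)]
  have h := alpha_bounds hL k
  have h0 : 0 ≤ 2 * L * alpha L k := by linarith [h.1, Nat.cast_nonneg (α := ℝ) k]
  have := pow_le_pow_left₀ h0 h.2 2
  linarith

end Coefficients

/-! ### The accelerated method with inexact gradients -/

section SimilarTriangles

variable {E : Type*} [NormedAddCommGroup E] [InnerProductSpace ℝ E]

/-- The similar triangles recursion with inexact gradients `G (lam k) + η k`. -/
structure SimilarTriangles (L : ℝ) (G : E → E) (η lam zeta y : ℕ → E) : Prop where
  zeta_zero : zeta 0 = 0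
  y_zero : y 0 = 0
  lam_succ : ∀ k, lam (k + 1) =
    (bigA L (k + 1))⁻¹ • (alpha L (k + 1) • zeta k + bigA L k • y k)
  zeta_succ : ∀ k, zeta (k + 1) = zeta k - alpha L (k + 1) • (G (lam (k + 1)) + η (k + 1))
  y_succ : ∀ k, y (k + 1) =
    (bigA L (k + 1))⁻¹ • (alpha L (k + 1) • zeta (k + 1) + bigA L k • y k)

variable {L : ℝ} {G : E → E} {η lam zeta y : ℕ → E}

theorem SimilarTriangles.step (h : SimilarTriangles L G η lam zeta y) (hL : 0 < L) {f : E → ℝ}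
    (hsmooth : ∀ x z, f z ≤ f x + ⟪G x, z - x⟫_ℝ + L / 2 * ‖z - x‖ ^ 2)
    (hconv : ∀ x z, f x + ⟪G x, z - x⟫_ℝ ≤ f z) (u : E) (k : ℕ) :
    bigA L (k + 1) * f (y (k + 1)) + 1 / 2 * ‖zeta (k + 1) - u‖ ^ 2 ≤
      bigA L k * f (y k) +
      alpha L (k + 1) * (f (lam (k + 1)) + ⟪G (lam (k + 1)), u - lam (k + 1)⟫_ℝ) +
      1 / 2 * ‖zeta k - u‖ ^ 2 + alpha L (k + 1) * ⟪η (k + 1), u - zeta k⟫_ℝ +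
      alpha L (k + 1) ^ 2 * ‖η (k + 1)‖ ^ 2 := by
  have hA := bigA_succ_pos hL k
  have hA0 := bigA_nonneg hL k
  have hAs := bigA_succ L k
  have hAq := bigA_eq hL (k + 1)
  have ha := alpha_succ_pos hL k
  have e1 : bigA L (k + 1) • lam (k + 1) = alpha L (k + 1) • zeta k + bigA L k • y k := by
    rw [h.lam_succ, smul_inv_smul₀ hA.ne']
  have e2 : y (k + 1) - lam (k + 1) =
      -((alpha L (k + 1)) ^ 2 / bigA L (k + 1)) • (G (lam (k + 1)) + η (k + 1)) := by
    rw [h.y_succ, h.lam_succ, ← smul_sub, h.zeta_succ, ← h.lam_succ]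
    module
  have h1 := hsmooth (lam (k + 1)) (y (k + 1))
  have h2 := hconv (lam (k + 1)) (y k)
  have e3 : zeta (k + 1) - u =
      (zeta k - u) - alpha L (k + 1) • (G (lam (k + 1)) + η (k + 1)) := by
    rw [h.zeta_succ]; abel
  have e4 : bigA L k * ⟪G (lam (k + 1)), y k - lam (k + 1)⟫_ℝ =
      alpha L (k + 1) * ⟪G (lam (k + 1)), lam (k + 1) - zeta k⟫_ℝ := by
    rw [← inner_smul_right, ← inner_smul_right]
    congr 1
    have : bigA L k • (y k - lam (k + 1)) - alpha L (k + 1) • (lam (k + 1) - zeta k) =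
        (alpha L (k + 1) • zeta k + bigA L k • y k) - (bigA L k + alpha L (k + 1)) • lam (k + 1) := by
      module
    rw [← sub_eq_zero, this, ← hAs, e1, sub_self]
  rw [e2, inner_smul_right, norm_smul, mul_pow, Real.norm_eq_abs, sq_abs, ← sub_nonneg] at h1
  rw [e3, norm_sub_sq_real, norm_smul, mul_pow, Real.norm_eq_abs, sq_abs, inner_smul_right]
  -- The move from `lam` to `y` is a gradient step of length `1 / (2 L)`, half the usual one; the
  -- slack absorbs the gradient error.
  have e5 : alpha L (k + 1) ^ 2 / bigA L (k + 1) = 1 / (2 * L) := by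
    rw [hAq]; field_simp
  rw [e5] at h1
  have h3 := mul_nonneg hA.le h1
  have h4 := mul_le_mul_of_nonneg_left h2 hA0
  set g := G (lam (k + 1))
  set a := alpha L (k + 1)
  set A := bigA L (k + 1)
  have e7 : A * (f (lam (k + 1)) + -(1 / (2 * L)) * ⟪g, g + η (k + 1)⟫_ℝ +
      L / 2 * ((-(1 / (2 * L))) ^ 2 * ‖g + η (k + 1)‖ ^ 2) - f (y (k + 1))) =
      A * f (lam (k + 1)) - a ^ 2 * ⟪g, g + η (k + 1)⟫_ℝ + 1 / 4 * a ^ 2 * ‖g + η (k + 1)‖ ^ 2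
        - A * f (y (k + 1)) := by
    have e8 : A * (1 / (2 * L)) = a ^ 2 := by rw [hAq]; field_simp
    have e9 : A * (L / 2 * (-(1 / (2 * L))) ^ 2) = 1 / 4 * a ^ 2 := by
      rw [← e8]; field_simp; norm_num
    linear_combination (-⟪g, g + η (k + 1)⟫_ℝ) * e8 + ‖g + η (k + 1)‖ ^ 2 * e9
  rw [e7] at h3
  have e10 : ⟪g, g + η (k + 1)⟫_ℝ = ‖g‖ ^ 2 + ⟪g, η (k + 1)⟫_ℝ := by
    rw [inner_add_right, real_inner_self_eq_norm_sq]
  have e11 := norm_add_sq_real g (η (k + 1))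
  have e12 : ⟪zeta k - u, g + η (k + 1)⟫_ℝ =
      -⟪g, u - lam (k + 1)⟫_ℝ - ⟪g, lam (k + 1) - zeta k⟫_ℝ - ⟪η (k + 1), u - zeta k⟫_ℝ := by
    simp only [inner_sub_left, inner_add_right, inner_sub_right, real_inner_comm (zeta k),
      real_inner_comm u]
    ring
  -- The second-order terms add up to `a² (‖η‖² - ‖g - η‖² / 4)`, so dropping this square leaves
  -- exactly the error `a² ‖η‖²`.
  have h5 : 0 ≤ a ^ 2 * ‖g - η (k + 1)‖ ^ 2 := by positivity
  rw [norm_sub_sq_real] at h5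
  rw [e12, e11]
  rw [e10, e11] at h3
  rw [mul_add, e4] at h4
  have e13 : A * f (lam (k + 1)) = bigA L k * f (lam (k + 1)) + a * f (lam (k + 1)) := by
    rw [hAs]; ring
  linarith

theorem SimilarTriangles.sum (h : SimilarTriangles L G η lam zeta y) (hL : 0 < L) {f : E → ℝ}
    (hsmooth : ∀ x z, f z ≤ f x + ⟪G x, z - x⟫_ℝ + L / 2 * ‖z - x‖ ^ 2)
    (hconv : ∀ x z, f x + ⟪G x, z - x⟫_ℝ ≤ f z) (u : E) (k : ℕ) :
    bigA L k * f (y k) + 1 / 2 * ‖zeta k - u‖ ^ 2 ≤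
      ∑ j ∈ Finset.range k,
        alpha L (j + 1) * (f (lam (j + 1)) + ⟪G (lam (j + 1)), u - lam (j + 1)⟫_ℝ) +
      1 / 2 * ‖u‖ ^ 2 + ∑ j ∈ Finset.range k, alpha L (j + 1) * ⟪η (j + 1), u - zeta j⟫_ℝ +
      ∑ j ∈ Finset.range k, alpha L (j + 1) ^ 2 * ‖η (j + 1)‖ ^ 2 := by
  induction k with
  | zero => simp [bigA_zero, h.zeta_zero]
  | succ k ih =>
    have := h.step hL hsmooth hconv u k
    simp only [Finset.sum_range_succ]
    linarith

theorem norm_convexCombination_sub_le {a b c R : ℝ} (ha : 0 ≤ a) (hb : 0 ≤ b) (hc : 0 < c)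
    (habc : c = b + a) {u v w : E} (hu : ‖u - w‖ ≤ R) (hv : ‖v - w‖ ≤ R) :
    ‖c⁻¹ • (a • u + b • v) - w‖ ≤ R := by
  have e : c⁻¹ • (a • u + b • v) - w = c⁻¹ • (a • (u - w) + b • (v - w)) := by
    have : w = c⁻¹ • (c • w) := (inv_smul_smul₀ hc.ne' w).symm
    conv_lhs => rw [this]
    rw [← smul_sub, habc]
    congr 1
    module
  rw [e, norm_smul, norm_inv, Real.norm_of_nonneg hc.le, inv_mul_le_iff₀ hc]
  refine (norm_add_le _ _).trans ?_
  rw [norm_smul, norm_smul, Real.norm_of_nonneg ha, Real.norm_of_nonneg hb, habc, add_mul, add_comm]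
  gcongr

theorem SimilarTriangles.norm_y_sub_le (h : SimilarTriangles L G η lam zeta y) (hL : 0 < L)
    {w : E} {R : ℝ} {k : ℕ} (hz : ∀ j ≤ k, ‖zeta j - w‖ ≤ R) : ‖y k - w‖ ≤ R := by
  induction k with
  | zero => rw [h.y_zero, ← h.zeta_zero]; exact hz 0 le_rfl
  | succ k ih =>
    rw [h.y_succ]
    exact norm_convexCombination_sub_le (alpha_succ_pos hL k).le (bigA_nonneg hL k)
      (bigA_succ_pos hL k) (bigA_succ L k) (hz _ le_rfl) (ih fun j hj => hz j (by omega))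

theorem SimilarTriangles.norm_lam_sub_le (h : SimilarTriangles L G η lam zeta y) (hL : 0 < L)
    {w : E} {R : ℝ} {k : ℕ} (hz : ∀ j ≤ k, ‖zeta j - w‖ ≤ R) : ‖lam (k + 1) - w‖ ≤ R := by
  rw [h.lam_succ]
  exact norm_convexCombination_sub_le (alpha_succ_pos hL k).le (bigA_nonneg hL k)
    (bigA_succ_pos hL k) (bigA_succ L k) (hz _ le_rfl) (h.norm_y_sub_le hL hz)

/-- `v` inside the ball of radius `R`, and `0` outside. -/
def truncate {E : Type*} [NormedAddCommGroup E] (R : ℝ) (v : E) : E := if ‖v‖ ≤ R then v else 0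

theorem norm_truncate_le {E : Type*} [NormedAddCommGroup E] {R : ℝ} (hR : 0 ≤ R)
    (v : E) : ‖truncate R v‖ ≤ R := by
  unfold truncate
  split_ifs with h
  · exact h
  · simpa using hR

theorem truncate_of_le {E : Type*} [NormedAddCommGroup E] {R : ℝ} {v : E} (h : ‖v‖ ≤ R) :
    truncate R v = v := if_pos h

/-- The iterates stay in a ball around a minimizer if the noise is small. -/
theorem SimilarTriangles.norm_zeta_sub_le (h : SimilarTriangles L G η lam zeta y) (hL : 0 < L)
    {f : E → ℝ} (hsmooth : ∀ x z, f z ≤ f x + ⟪G x, z - x⟫_ℝ + L / 2 * ‖z - x‖ ^ 2)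
    (hconv : ∀ x z, f x + ⟪G x, z - x⟫_ℝ ≤ f z) {w : E} (hw : ∀ z, f w ≤ f z) {R t : ℝ}
    (hR : 0 ≤ R) (hwR : ‖w‖ ≤ R) (ht0 : 0 ≤ t) (ht : t ≤ 1 / 4) {N : ℕ}
    (hmart : ∀ k ≤ N, |∑ j ∈ Finset.range k,
      alpha L (j + 1) * ⟪η (j + 1), truncate (2 * R) (w - zeta j)⟫_ℝ| ≤ 2 * t * R ^ 2)
    (hsq : ∑ j ∈ Finset.range N, alpha L (j + 1) ^ 2 * ‖η (j + 1)‖ ^ 2 ≤ t ^ 2 * R ^ 2) :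
    ∀ k ≤ N, ‖zeta k - w‖ ≤ 2 * R := by
  intro k
  induction k using Nat.strong_induction_on with
  | _ k ih =>
    intro hk
    have h1 := h.sum hL hsmooth hconv w k
    have h2 : ∑ j ∈ Finset.range k,
        alpha L (j + 1) * (f (lam (j + 1)) + ⟪G (lam (j + 1)), w - lam (j + 1)⟫_ℝ) ≤
        bigA L k * f (y k) := by
      rw [bigA_eq_sum, Finset.sum_mul]
      refine Finset.sum_le_sum fun j _ => ?_
      exact mul_le_mul_of_nonneg_left ((hconv _ _).trans (hw _)) (alpha_succ_pos hL j).le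
    -- Only `zeta j` with `j < k` occurs here, and by the induction hypothesis the truncation does
    -- not act on these.
    have h3 : ∑ j ∈ Finset.range k, alpha L (j + 1) * ⟪η (j + 1), w - zeta j⟫_ℝ ≤
        2 * t * R ^ 2 := by
      refine le_trans (le_of_eq (Finset.sum_congr rfl fun j hj => ?_))
        ((le_abs_self _).trans (hmart k hk))
      have hj' := Finset.mem_range.1 hj
      rw [truncate_of_le]
      rw [norm_sub_rev]
      exact ih j hj' (by omega)
    have h4 : ∑ j ∈ Finset.range k, alpha L (j + 1) ^ 2 * ‖η (j + 1)‖ ^ 2 ≤ t ^ 2 * R ^ 2 := by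
      refine le_trans (Finset.sum_le_sum_of_subset_of_nonneg (Finset.range_mono hk) ?_) hsq
      intro j _ _
      positivity
    have h5 : ‖w‖ ^ 2 ≤ R ^ 2 := pow_le_pow_left₀ (norm_nonneg _) hwR 2
    -- Since `t ≤ 1 / 4`, half the left side is at most `(1 / 2 + 1 / 2 + 1 / 16) R²`, well below `2
    -- R²`.
    have h6 : ‖zeta k - w‖ ^ 2 ≤ (2 * R) ^ 2 := by
      have h7 : t ^ 2 * R ^ 2 ≤ 1 / 16 * R ^ 2 := by gcongr; nlinarith
      have h8 : 2 * t * R ^ 2 ≤ 2 * (1 / 4) * R ^ 2 := by gcongr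
      nlinarith [sq_nonneg R]
    exact le_of_sq_le_sq h6 (by positivity)

end SimilarTriangles

/-! ### From dual progress to primal gap and feasibility -/

section PrimalDual

variable {E : Type*} [NormedAddCommGroup E] [InnerProductSpace ℝ E]

/-- The weighted average of a sequence of points. -/
def weightedAverage (L : ℝ) (N : ℕ) (x : ℕ → E) : E :=
  (bigA L N)⁻¹ • ∑ j ∈ Finset.range N, alpha L (j + 1) • x (j + 1)

variable {L : ℝ} {N : ℕ}

theorem smul_weightedAverage (hL : 0 < L) (hN : N ≠ 0) (x : ℕ → E) :
    bigA L N • weightedAverage L N x = ∑ j ∈ Finset.range N, alpha L (j + 1) • x (j + 1) := by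
  obtain ⟨k, rfl⟩ := Nat.exists_eq_succ_of_ne_zero hN
  exact smul_inv_smul₀ (bigA_succ_pos hL k).ne' _

theorem weightedAverage_eq_sum (L : ℝ) (N : ℕ) (x : ℕ → E) :
    weightedAverage L N x =
      ∑ j ∈ Finset.range N, ((bigA L N)⁻¹ * alpha L (j + 1)) • x (j + 1) := by
  rw [weightedAverage, Finset.smul_sum]
  simp_rw [smul_smul]

theorem sum_weights (hL : 0 < L) (hN : N ≠ 0) :
    ∑ j ∈ Finset.range N, (bigA L N)⁻¹ * alpha L (j + 1) = 1 := by
  obtain ⟨k, rfl⟩ := Nat.exists_eq_succ_of_ne_zero hN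
  rw [← Finset.mul_sum, ← bigA_eq_sum]
  exact inv_mul_cancel₀ (bigA_succ_pos hL k).ne'

theorem weight_nonneg (hL : 0 < L) (N j : ℕ) : 0 ≤ (bigA L N)⁻¹ * alpha L (j + 1) :=
  mul_nonneg (inv_nonneg.2 (bigA_nonneg hL N)) (alpha_succ_pos hL j).le

theorem norm_weightedAverage_sub_le (hL : 0 < L) (hN : N ≠ 0) {x : ℕ → E} {w : E} {D : ℝ}
    (hx : ∀ j < N, ‖x (j + 1) - w‖ ≤ D) : ‖weightedAverage L N x - w‖ ≤ D := by
  have h : weightedAverage L N x ∈ Metric.closedBall w D := by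
    rw [weightedAverage_eq_sum]
    refine (convex_closedBall w D).sum_mem (fun j _ => weight_nonneg hL N j) (sum_weights hL hN)
      fun j hj => ?_
    rw [Metric.mem_closedBall, dist_eq_norm]
    exact hx j (Finset.mem_range.1 hj)
  rwa [Metric.mem_closedBall, dist_eq_norm] at h

theorem bigA_mul_apply_weightedAverage_le (hL : 0 < L) (hN : N ≠ 0) {F : E → ℝ}
    (hF : ConvexOn ℝ Set.univ F) (x : ℕ → E) :
    bigA L N * F (weightedAverage L N x) ≤
      ∑ j ∈ Finset.range N, alpha L (j + 1) * F (x (j + 1)) := by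
  have h := hF.map_sum_le (t := Finset.range N) (w := fun j => (bigA L N)⁻¹ * alpha L (j + 1))
    (p := fun j => x (j + 1)) (fun j _ => weight_nonneg hL N j) (sum_weights hL hN)
    fun _ _ => Set.mem_univ _
  rw [← weightedAverage_eq_sum] at h
  have h2 := mul_le_mul_of_nonneg_left h (bigA_nonneg hL N)
  refine h2.trans (le_of_eq ?_)
  obtain ⟨k, rfl⟩ := Nat.exists_eq_succ_of_ne_zero hN
  have hA := (bigA_succ_pos hL k).ne'
  rw [Finset.mul_sum]
  refine Finset.sum_congr rfl fun j _ => ?_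
  rw [smul_eq_mul, ← mul_assoc, ← mul_assoc, Nat.succ_eq_add_one, mul_inv_cancel₀ hA, one_mul]

/-- Dual problem data: `p y` maximizes `⟪y, x⟫ - F x`, the operator `B` defines the constraint
`B x = 0`, `xs` is the primal and `ys` the dual solution. -/
structure DualPair (F : E → ℝ) (p : E → E) (B : E →L[ℝ] E) (xs ys : E) : Prop where
  convexOn : ConvexOn ℝ Set.univ F
  inner_sub_le : ∀ y x, ⟪y, x⟫_ℝ - F x ≤ ⟪y, p y⟫_ℝ - F (p y)
  inner_left : ∀ u v, ⟪B u, v⟫_ℝ = ⟪u, B v⟫_ℝ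
  feasible : B xs = 0
  optimal : ∀ x, B x = 0 → F xs ≤ F x
  stationary : B (p (B ys)) = 0

variable {F : E → ℝ} {p : E → E} {B : E →L[ℝ] E} {xs ys : E}

theorem DualPair.add_inner_le (h : DualPair F p B xs ys) (x z : E) :
    ⟪B x, p (B x)⟫_ℝ - F (p (B x)) + ⟪B (p (B x)), z - x⟫_ℝ ≤ ⟪B z, p (B z)⟫_ℝ - F (p (B z)) := by
  have h1 := h.inner_sub_le (B z) (p (B x))
  rw [h.inner_left (p (B x)), map_sub, inner_sub_right, real_inner_comm (B x),
    real_inner_comm (B z)]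
  linarith

theorem DualPair.dual_le (h : DualPair F p B xs ys) (z : E) :
    ⟪B ys, p (B ys)⟫_ℝ - F (p (B ys)) ≤ ⟪B z, p (B z)⟫_ℝ - F (p (B z)) := by
  have := h.add_inner_le ys z
  rwa [h.stationary, inner_zero_left, add_zero] at this

theorem DualPair.weak_duality (h : DualPair F p B xs ys) (z : E) :
    -F xs ≤ ⟪B z, p (B z)⟫_ℝ - F (p (B z)) := by
  have := h.inner_sub_le (B z) xs
  rw [h.inner_left, h.feasible, inner_zero_right] at this
  linarith

/-- Stationarity makes `p (B ys)` feasible, so its value is at least `F xs`; comparing `x` with this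
maximizer gives `F x - F xs ≥ ⟪ys, B x⟫`. -/
theorem DualPair.neg_norm_le (h : DualPair F p B xs ys) (x : E) :
    -(‖ys‖ * ‖B x‖) ≤ F x - F xs := by
  have h1 := h.inner_sub_le (B ys) x
  have h2 := h.optimal _ h.stationary
  rw [h.inner_left, h.inner_left, h.stationary, inner_zero_right] at h1
  have h3 := neg_le_of_abs_le (abs_real_inner_le_norm ys (B x))
  linarith

theorem DualPair.bounds (h : DualPair F p B xs ys) (hL : 0 < L) (hN : N ≠ 0)
    {e lam zeta y : ℕ → E}
    (hsim : SimilarTriangles L (fun z => B (p (B z))) (fun k => B (e k)) lam zeta y)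
    (hsmooth : ∀ x z, ⟪B z, p (B z)⟫_ℝ - F (p (B z)) ≤ ⟪B x, p (B x)⟫_ℝ - F (p (B x)) +
      ⟪B (p (B x)), z - x⟫_ℝ + L / 2 * ‖z - x‖ ^ 2)
    {R t : ℝ} (hR : 0 < R) (hyR : ‖ys‖ ≤ R) (ht0 : 0 ≤ t) (ht : t ≤ 1 / 4)
    (hmart : ∀ k ≤ N, |∑ j ∈ Finset.range k,
      alpha L (j + 1) * ⟪B (e (j + 1)), truncate (2 * R) (ys - zeta j)⟫_ℝ| ≤ 2 * t * R ^ 2)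
    (hsq : ∑ j ∈ Finset.range N, alpha L (j + 1) ^ 2 * ‖B (e (j + 1))‖ ^ 2 ≤ t ^ 2 * R ^ 2)
    (hsum : ‖B (∑ j ∈ Finset.range N, alpha L (j + 1) • e (j + 1))‖ ≤ t * R) :
    (∀ j < N, ‖lam (j + 1) - ys‖ ≤ 2 * R) ∧
    bigA L N * (F (weightedAverage L N fun k => p (B (lam k))) - F xs) ≤ 4 * R ^ 2 ∧
    bigA L N * (R * ‖B (weightedAverage L N fun k => p (B (lam k)))‖) ≤ 4 * R ^ 2 := by
  have hz := hsim.norm_zeta_sub_le hL (f := fun z => ⟪B z, p (B z)⟫_ℝ - F (p (B z))) hsmooth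
    h.add_inner_le h.dual_le hR.le hyR ht0 ht hmart hsq
  refine ⟨fun j hj => hsim.norm_lam_sub_le hL fun i hi => hz i (by omega), ?_⟩
  set x := weightedAverage L N fun k => p (B (lam k)) with hx
  -- The maximizer of `-⟪u, B x⟫` over the ball of radius `2 R`. The factor `2` exceeds the bound on
  -- `‖ys‖` by `R`, so a multiple of `‖B x‖` survives the possibly negative primal gap. If `B x =
  -- 0`, division by zero gives `u = 0`.
  set u : E := -((2 * R / ‖B x‖) • B x) with hu
  have hA := bigA_nonneg hL N
  have hu2 : ‖u‖ ≤ 2 * R := by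
    rw [hu, norm_neg, norm_smul, norm_div, norm_norm, Real.norm_of_nonneg (by positivity)]
    rcases eq_or_ne (‖B x‖) 0 with h0 | h0
    · rw [h0]; simp; positivity
    · rw [div_mul_cancel₀ _ h0]
  have hui : ⟪u, B x⟫_ℝ = -(2 * R * ‖B x‖) := by
    rw [hu, inner_neg_left, real_inner_smul_left, real_inner_self_eq_norm_sq]
    rcases eq_or_ne (‖B x‖) 0 with h0 | h0
    · rw [h0]; simp
    · field_simp
  have h1 := hsim.sum hL (f := fun z => ⟪B z, p (B z)⟫_ℝ - F (p (B z))) hsmooth h.add_inner_le u N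
  have h2 : ∑ j ∈ Finset.range N, alpha L (j + 1) * (⟪B (lam (j + 1)), p (B (lam (j + 1)))⟫_ℝ -
      F (p (B (lam (j + 1)))) + ⟪B (p (B (lam (j + 1)))), u - lam (j + 1)⟫_ℝ) ≤
      bigA L N * (⟪u, B x⟫_ℝ - F x) := by
    have h3 := bigA_mul_apply_weightedAverage_le hL hN h.convexOn fun k => p (B (lam k))
    have h4 : bigA L N * ⟪u, B x⟫_ℝ =
        ∑ j ∈ Finset.range N, alpha L (j + 1) * ⟪u, B (p (B (lam (j + 1))))⟫_ℝ := by
      rw [← inner_smul_right, ← map_smul, hx, smul_weightedAverage hL hN, map_sum, inner_sum]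
      simp_rw [map_smul, inner_smul_right]
    rw [mul_sub, h4]
    have h5 : ∀ j ∈ Finset.range N, alpha L (j + 1) * (⟪B (lam (j + 1)), p (B (lam (j + 1)))⟫_ℝ -
        F (p (B (lam (j + 1)))) + ⟪B (p (B (lam (j + 1)))), u - lam (j + 1)⟫_ℝ) =
        alpha L (j + 1) * ⟪u, B (p (B (lam (j + 1))))⟫_ℝ -
        alpha L (j + 1) * F (p (B (lam (j + 1)))) := fun j _ => by
      rw [inner_sub_right, real_inner_comm u, real_inner_comm (lam (j + 1)), h.inner_left (lam _)]
      ring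
    rw [Finset.sum_congr rfl h5, Finset.sum_sub_distrib]
    linarith
  have h6 : ∑ j ∈ Finset.range N, alpha L (j + 1) * ⟪B (e (j + 1)), u - zeta j⟫_ℝ ≤
      t * R * (3 * R) + 2 * t * R ^ 2 := by
    -- The point `u` depends on the whole trajectory, so no martingale bound applies to it directly.
    -- Splitting at `ys` moves it outside the sum, where the norm of the total noise suffices; the
    -- rest has predictable directions.
    have h7 : ∀ j ∈ Finset.range N, alpha L (j + 1) * ⟪B (e (j + 1)), u - zeta j⟫_ℝ =
        alpha L (j + 1) * ⟪B (e (j + 1)), u - ys⟫_ℝ +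
        alpha L (j + 1) * ⟪B (e (j + 1)), truncate (2 * R) (ys - zeta j)⟫_ℝ := fun j hj => by
      rw [truncate_of_le, ← mul_add, ← inner_add_right, sub_add_sub_cancel]
      rw [norm_sub_rev]
      exact hz j (Finset.mem_range.1 hj).le
    rw [Finset.sum_congr rfl h7, Finset.sum_add_distrib]
    have h8 : ∑ j ∈ Finset.range N, alpha L (j + 1) * ⟪B (e (j + 1)), u - ys⟫_ℝ =
        ⟪B (∑ j ∈ Finset.range N, alpha L (j + 1) • e (j + 1)), u - ys⟫_ℝ := by
      rw [map_sum, sum_inner]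
      simp_rw [map_smul, real_inner_smul_left]
    rw [h8]
    have h9 : ‖u - ys‖ ≤ 3 * R := (norm_sub_le _ _).trans (by linarith)
    have h10 := (real_inner_le_norm _ _).trans
      (mul_le_mul hsum h9 (norm_nonneg _) (by positivity : 0 ≤ t * R))
    have h11 := (le_abs_self _).trans (hmart N le_rfl)
    linarith
  have h12 := mul_le_mul_of_nonneg_left (h.weak_duality (y N)) hA
  have h13 : ‖u‖ ^ 2 ≤ (2 * R) ^ 2 := pow_le_pow_left₀ (norm_nonneg _) hu2 2
  have h14 := mul_le_mul_of_nonneg_left (h.neg_norm_le x) hA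
  have h15 : bigA L N * (‖ys‖ * ‖B x‖) ≤ bigA L N * (R * ‖B x‖) := by gcongr
  have h16 : 0 ≤ bigA L N * (R * ‖B x‖) := by positivity
  have h17 : t * R * (3 * R) + 2 * t * R ^ 2 + t ^ 2 * R ^ 2 ≤ 2 * R ^ 2 := by
    have : (5 * t + t ^ 2) * R ^ 2 ≤ 2 * R ^ 2 := by gcongr; nlinarith
    linarith
  have h18 : 0 ≤ 1 / 2 * ‖zeta N - u‖ ^ 2 := by positivity
  rw [hui] at h2
  have h19 : bigA L N * (F x - F xs) + 2 * (bigA L N * (R * ‖B x‖)) ≤ 4 * R ^ 2 := by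
    linarith
  constructor <;> linarith

end PrimalDual

/-! ### The stochastic run as an inexact method; adaptedness -/

section Trajectory

variable {m n : ℕ} {Ξ : Type*} [mΞ : MeasurableSpace Ξ] {ν : Measure Ξ} {F : Stacked m n → ℝ}
  {S : StochasticDual ν F} {W : Matrix (Fin m × Fin n) (Fin m × Fin n) ℝ} {L : ℝ} {r : ℕ → ℕ}

/-- The averaged noise of the oracle answers in iteration `k`. -/
def batchNoise (S : StochasticDual ν F) (W : Matrix (Fin m × Fin n) (Fin m × Fin n) ℝ) (L : ℝ)
    (r : ℕ → ℕ) (x : ℕ → ℕ → Ξ) (k : ℕ) : Stacked m n :=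
  S.batchPoint W (run S W L r x k).lam (x k) (r k) -
    primalPoint F (sqrtOp W (run S W L r x k).lam)

theorem StochasticDual.batchGrad_eq (S : StochasticDual ν F)
    (W : Matrix (Fin m × Fin n) (Fin m × Fin n) ℝ) (y : Stacked m n) (x : ℕ → Ξ) (r : ℕ) :
    S.batchGrad W y x r = sqrtOp W (S.batchPoint W y x r) := by
  simp_rw [StochasticDual.batchGrad, StochasticDual.batchPoint, S.gradPsi_eq, map_smul, map_sum]

theorem similarTriangles_run (S : StochasticDual ν F)
    (W : Matrix (Fin m × Fin n) (Fin m × Fin n) ℝ) (L : ℝ) (r : ℕ → ℕ) (x : ℕ → ℕ → Ξ) :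
    SimilarTriangles L (fun z => sqrtOp W (primalPoint F (sqrtOp W z)))
      (fun k => sqrtOp W (batchNoise S W L r x k)) (fun k => (run S W L r x k).lam)
      (fun k => (run S W L r x k).zeta) (fun k => (run S W L r x k).y) where
  zeta_zero := rfl
  y_zero := rfl
  lam_succ _ := rfl
  zeta_succ k := by
    rw [← map_add, batchNoise, add_sub_cancel, ← S.batchGrad_eq]
    rfl
  y_succ _ := rfl

theorem batchNoise_eq (x : ℕ → ℕ → Ξ) {k : ℕ} (hr : 0 < r k) :
    batchNoise S W L r x k = (r k : ℝ)⁻¹ •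
      ∑ s ∈ Finset.range (r k), S.noise (sqrtOp W (run S W L r x k).lam) (x k s) := by
  have hr' : (r k : ℝ) ≠ 0 := by positivity
  simp_rw [StochasticDual.noise]
  rw [Finset.sum_sub_distrib, Finset.sum_const, Finset.card_range, smul_sub, ← Nat.cast_smul_eq_nsmul ℝ,
    inv_smul_smul₀ hr']
  rfl

/-- Separates the output into the average covered by `DualPair.bounds` and a noise average. The term
with index `0` drops out because `α_0 = 0`. -/
theorem output_eq (x : ℕ → ℕ → Ξ) (N : ℕ) :
    output S W L r x N =
      weightedAverage L N (fun k => primalPoint F (sqrtOp W (run S W L r x k).lam)) +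
      (bigA L N)⁻¹ • ∑ j ∈ Finset.range N, alpha L (j + 1) • batchNoise S W L r x (j + 1) := by
  rw [output, weightedAverage, ← smul_add, ← Finset.sum_add_distrib, Finset.sum_range_succ']
  congr 1
  have h0 : alpha L 0 = 0 := rfl
  rw [h0, zero_smul, add_zero]
  refine Finset.sum_congr rfl fun j _ => ?_
  rw [← smul_add, batchNoise, add_sub_cancel]

theorem run_calls (x : ℕ → ℕ → Ξ) (N : ℕ) :
    (run S W L r x N).calls = ∑ j ∈ Finset.range N, r (j + 1) := by
  induction N with
  | zero => rfl
  | succ N ih => rw [Finset.sum_range_succ, ← ih]; rfl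

variable {Ω : Type*} [mΩ : MeasurableSpace Ω] {ξ : ℕ → ℕ → Ω → Ξ} {μ : ℝ}

theorem StochasticDual.measurable_gradPsi (S : StochasticDual ν F)
    (W : Matrix (Fin m × Fin n) (Fin m × Fin n) ℝ) :
    Measurable (Function.uncurry (S.gradPsi W)) := by
  have h : Function.uncurry (S.gradPsi W) = fun q : Stacked m n × Ξ =>
      sqrtOp W (Function.uncurry S.point (sqrtOp W q.1, q.2)) :=
    funext fun q => S.gradPsi_eq W q.1 q.2
  rw [h]
  exact (sqrtOp W).continuous.measurable.comp (S.measurable_point.comp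
    (((sqrtOp W).continuous.measurable.comp measurable_fst).prodMk measurable_snd))

theorem StochasticDual.measurable_noise_sqrtOp (S : StochasticDual ν F) (hμ : 0 < μ)
    (hF : StrongConvexOn Set.univ μ F) (W : Matrix (Fin m × Fin n) (Fin m × Fin n) ℝ) :
    Measurable fun q : Stacked m n × Ξ => S.noise (sqrtOp W q.1) q.2 := by
  have h : (fun q : Stacked m n × Ξ => S.noise (sqrtOp W q.1) q.2) =
      fun q => Function.uncurry S.noise (sqrtOp W q.1, q.2) := rfl
  rw [h]
  exact (S.measurable_noise hμ hF).comp
    (((sqrtOp W).continuous.measurable.comp measurable_fst).prodMk measurable_snd)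

theorem measurable_lam_succ {T : Set (ℕ × ℕ)} {k : ℕ}
    (hz : Measurable[sigmaOf ξ T] fun ω => (run S W L r (fun k s => ξ k s ω) k).zeta)
    (hy : Measurable[sigmaOf ξ T] fun ω => (run S W L r (fun k s => ξ k s ω) k).y) :
    Measurable[sigmaOf ξ T] fun ω => (run S W L r (fun k s => ξ k s ω) (k + 1)).lam :=
  ((hz.const_smul (alpha L (k + 1))).add (hy.const_smul (bigA L k))).const_smul
    (bigA L (k + 1))⁻¹

/-- Predictability: `zeta` and `y` after `k` iterations use only the first `k` rows, and so does the
next query point. -/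
theorem measurable_run (S : StochasticDual ν F)
    (W : Matrix (Fin m × Fin n) (Fin m × Fin n) ℝ) (L : ℝ) (r : ℕ → ℕ) (ξ : ℕ → ℕ → Ω → Ξ)
    (k : ℕ) :
    (Measurable[sigmaOf ξ (rowsUpTo k)] fun ω => (run S W L r (fun k s => ξ k s ω) k).zeta) ∧
    (Measurable[sigmaOf ξ (rowsUpTo k)] fun ω => (run S W L r (fun k s => ξ k s ω) k).y) := by
  induction k with
  | zero => exact ⟨measurable_const, measurable_const⟩
  | succ k ih =>
    have hle := sigmaOf_mono ξ
      (show rowsUpTo k ⊆ rowsUpTo (k + 1) from fun p hp => le_trans hp (Nat.le_succ k))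
    have hz := ih.1.mono hle le_rfl
    have hy := ih.2.mono hle le_rfl
    have hl := measurable_lam_succ hz hy
    have hg : Measurable[sigmaOf ξ (rowsUpTo (k + 1))] fun ω => S.batchGrad W
        (run S W L r (fun k s => ξ k s ω) (k + 1)).lam (fun s => ξ (k + 1) s ω) (r (k + 1)) := by
      have hsum : Measurable[sigmaOf ξ (rowsUpTo (k + 1))] fun ω =>
          ∑ s ∈ Finset.range (r (k + 1)), S.gradPsi W
            (run S W L r (fun k s => ξ k s ω) (k + 1)).lam (ξ (k + 1) s ω) := by
        refine Finset.measurable_fun_sum _ fun s _ => ?_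
        have hx : Measurable[sigmaOf ξ (rowsUpTo (k + 1))] (ξ (k + 1) s) :=
          measurable_sample ξ (le_refl (k + 1))
        exact (S.measurable_gradPsi W).comp (hl.prodMk hx)
      exact hsum.const_smul (r (k + 1) : ℝ)⁻¹
    have hz' : Measurable[sigmaOf ξ (rowsUpTo (k + 1))] fun ω =>
        (run S W L r (fun k s => ξ k s ω) (k + 1)).zeta :=
      hz.sub (hg.const_smul (alpha L (k + 1)))
    exact ⟨hz', ((hz'.const_smul (alpha L (k + 1))).add (hy.const_smul (bigA L k))).const_smul
      (bigA L (k + 1))⁻¹⟩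

theorem measurable_run_lam (S : StochasticDual ν F)
    (W : Matrix (Fin m × Fin n) (Fin m × Fin n) ℝ) (L : ℝ) (r : ℕ → ℕ) (ξ : ℕ → ℕ → Ω → Ξ)
    (k : ℕ) :
    Measurable[sigmaOf ξ (rowsUpTo k)] fun ω =>
      (run S W L r (fun k s => ξ k s ω) (k + 1)).lam :=
  measurable_lam_succ (measurable_run S W L r ξ k).1 (measurable_run S W L r ξ k).2

end Trajectory

/-! ### Accuracy on the event of small noise -/

section Deterministic

variable {m n : ℕ} {Ξ : Type*} [MeasurableSpace Ξ] {ν : Measure Ξ} {F : Stacked m n → ℝ}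
  {S : StochasticDual ν F} {G : SimpleGraph (Fin m)} [DecidableRel G.Adj] {L μ : ℝ} {r : ℕ → ℕ}
  {xstar ystar : Stacked m n}

theorem dualPair (hG : G.Connected) (hμ : 0 < μ) (hF : StrongConvexOn Set.univ μ F)
    (hx : xstar ∈ consensus m n) (hmin : IsMinOn F (consensus m n) xstar)
    (hy : IsMinOn (dualObj (commMatrix n G) F) Set.univ ystar) :
    DualPair F (primalPoint F) (sqrtOp (commMatrix n G)) xstar ystar where
  convexOn := hF.convexOn fun r => by positivity
  inner_sub_le y x := by
    rw [← conj_eq hμ hF]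
    exact inner_sub_le_conj hμ hF y x
  inner_left := sqrtOp_inner_left _
  feasible := (sqrtOp_eq_zero_iff hG _).2 hx
  optimal x hx := hmin ((sqrtOp_eq_zero_iff hG _).1 hx)
  stationary := by
    have h := (hasGradientAt_dualObj hμ hF (commMatrix n G) ystar).hasFDerivAt
    have h2 := (hy.isLocalMin Filter.univ_mem).hasFDerivAt_eq_zero h
    exact (map_eq_zero_iff _ (InnerProductSpace.toDual ℝ _).injective).1 h2

/-- Accuracy of the output on the event where the accumulated noise is small. -/
theorem output_accuracy (hG : G.Connected) (hμ : 0 < μ) (hF : StrongConvexOn Set.univ μ F)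
    (hx : xstar ∈ consensus m n) (hmin : IsMinOn F (consensus m n) xstar)
    (hy : IsMinOn (dualObj (commMatrix n G) F) Set.univ ystar) (hL : 0 < L)
    (hlip : ∀ y z, ‖gradient (dualObj (commMatrix n G) F) y -
      gradient (dualObj (commMatrix n G) F) z‖ ≤ L * ‖y - z‖)
    {N : ℕ} (hN : N ≠ 0) {R t ρ ε R_F : ℝ} {L_F : ℝ≥0} {x : ℕ → ℕ → Ξ} (hR : 0 < R)
    (hyR : ‖ystar‖ ≤ R) (ht0 : 0 ≤ t) (ht : t ≤ 1 / 4) (htρ : ρ * t ≤ 1)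
    (hΛ : 0 < lamMax (commMatrix n G))
    (hacc : 5 * R ^ 2 ≤ bigA L N * ε)
    (hRF : 4 * max (R / bigA L N * √(1 / lamMax (commMatrix n G)))
      (max (√(lamMax (commMatrix n G)) * R / μ)
        ‖primalPoint F (sqrtOp (commMatrix n G) ystar)‖) ≤ R_F)
    (hLF : LipschitzOnWith L_F F (Metric.closedBall 0 R_F))
    (hLFρ : L_F ≤ ρ * (R * √(lamMax (commMatrix n G))))
    (hmart : ∀ k ≤ N, |∑ j ∈ Finset.range k, alpha L (j + 1) *
      ⟪sqrtOp (commMatrix n G) (batchNoise S (commMatrix n G) L r x (j + 1)),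
        truncate (2 * R) (ystar - (run S (commMatrix n G) L r x j).zeta)⟫_ℝ| ≤ 2 * t * R ^ 2)
    (hsq : ∑ j ∈ Finset.range N, lamMax (commMatrix n G) *
      ‖alpha L (j + 1) • batchNoise S (commMatrix n G) L r x (j + 1)‖ ^ 2 ≤ t ^ 2 * R ^ 2)
    (hsum : √(lamMax (commMatrix n G)) * ‖∑ j ∈ Finset.range N,
      alpha L (j + 1) • batchNoise S (commMatrix n G) L r x (j + 1)‖ ≤ t * R) :
    F (output S (commMatrix n G) L r x N) - F xstar ≤ ε ∧
      ‖sqrtOp (commMatrix n G) (output S (commMatrix n G) L r x N)‖ ≤ ε / R := by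
  have hD := dualPair hG hμ hF hx hmin hy
  have hW := posSemidef_commMatrix (n := n) (G := G)
  have hA : 0 < bigA L N := by
    obtain ⟨k, rfl⟩ := Nat.exists_eq_succ_of_ne_zero hN
    exact bigA_succ_pos hL k
  have hsim := similarTriangles_run S (commMatrix n G) L r x
  set W := commMatrix n G with hWdef
  set B := sqrtOp W with hB
  have hB' : ∀ v, ‖B v‖ ≤ √(lamMax W) * ‖v‖ := norm_sqrtOp_le hW
  set Λ := lamMax W
  have hsΛ : 0 < √Λ := Real.sqrt_pos.2 hΛ
  set e := batchNoise S W L r x with he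
  set D := ∑ j ∈ Finset.range N, alpha L (j + 1) • e (j + 1) with hDdef
  have hgrad : ∀ z, gradient (dualObj W F) z = B (primalPoint F (B z)) :=
    fun z => (hasGradientAt_dualObj hμ hF W z).gradient
  have hsmooth : ∀ u z, ⟪B z, primalPoint F (B z)⟫_ℝ - F (primalPoint F (B z)) ≤
      ⟪B u, primalPoint F (B u)⟫_ℝ - F (primalPoint F (B u)) +
      ⟪B (primalPoint F (B u)), z - u⟫_ℝ + L / 2 * ‖z - u‖ ^ 2 := fun u z => by
    rw [← conj_eq hμ hF, ← conj_eq hμ hF]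
    exact le_add_inner_add_of_lipschitz_gradient (f := dualObj W F)
      (g := fun z => B (primalPoint F (B z))) (hasGradientAt_dualObj hμ hF W)
      (fun y z => by rw [← hgrad, ← hgrad]; exact hlip y z) u z
  have hsq' : ∑ j ∈ Finset.range N, alpha L (j + 1) ^ 2 * ‖B (e (j + 1))‖ ^ 2 ≤ t ^ 2 * R ^ 2 := by
    refine (Finset.sum_le_sum fun j _ => ?_).trans hsq
    have h1 := norm_sqrtOp_sq_le hW (e (j + 1))
    rw [norm_smul, mul_pow, Real.norm_eq_abs, sq_abs, mul_left_comm]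
    exact mul_le_mul_of_nonneg_left h1 (sq_nonneg _)
  have hBD : ‖B D‖ ≤ t * R := (hB' D).trans hsum
  obtain ⟨hlam, hval, hfeas⟩ := hD.bounds hL hN hsim hsmooth hR hyR ht0 ht hmart hsq' hBD
  have hout := output_eq (S := S) (W := W) (L := L) (r := r) x N
  set xt := weightedAverage L N fun k => primalPoint F (B (run S W L r x k).lam) with hxt
  set xo := output S W L r x N with hxo
  have hDn : ‖D‖ ≤ t * R / √Λ := by
    rw [le_div_iff₀ hsΛ, mul_comm]; exact hsum
  have hdiff : ‖xo - xt‖ ≤ t * R / √Λ / bigA L N := by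
    rw [hout, add_sub_cancel_left, norm_smul, norm_inv, Real.norm_of_nonneg hA.le, ← div_eq_inv_mul]
    gcongr
  have hxt_ball : ‖xt - primalPoint F (B ystar)‖ ≤ 2 * (√Λ * R / μ) := by
    refine norm_weightedAverage_sub_le hL hN fun j hj => ?_
    refine (norm_primalPoint_sub_le hμ hF _ _).trans ?_
    rw [← map_sub, ← mul_div_assoc]
    gcongr
    refine (hB' _).trans ?_
    have := mul_le_mul_of_nonneg_left (hlam j hj) hsΛ.le
    linarith
  -- The exact average lies within `2 M` of a point of norm at most `M`, and the noise shifts it by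
  -- at most another `M`. The factor `4` in the radius thus puts both points in the region where `F`
  -- is Lipschitz.
  set M := max (R / bigA L N * √(1 / Λ)) (max (√Λ * R / μ) ‖primalPoint F (B ystar)‖) with hM
  have hM1 : R / bigA L N * √(1 / Λ) ≤ M := le_max_left _ _
  have hM2 : √Λ * R / μ ≤ M := (le_max_left _ _).trans (le_max_right _ _)
  have hM3 : ‖primalPoint F (B ystar)‖ ≤ M := (le_max_right _ _).trans (le_max_right _ _)
  have hM0 : 0 ≤ M := (norm_nonneg _).trans hM3
  have hxt_norm : ‖xt‖ ≤ 3 * M := by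
    have := norm_le_norm_sub_add xt (primalPoint F (B ystar))
    linarith
  have hdiffM : ‖xo - xt‖ ≤ M := by
    refine hdiff.trans (le_trans ?_ hM1)
    rw [Real.sqrt_div zero_le_one, Real.sqrt_one]
    have : t * R / √Λ / bigA L N = t * (R / bigA L N * (1 / √Λ)) := by field_simp
    rw [this]
    have h0 : 0 ≤ R / bigA L N * (1 / √Λ) := by positivity
    nlinarith
  have hxo_norm : ‖xo‖ ≤ 4 * M := by
    have := norm_le_norm_sub_add xo xt
    linarith
  have hF1 : F xo - F xt ≤ L_F * ‖xo - xt‖ := by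
    have h1 := hLF.dist_le_mul xo (by rw [mem_closedBall_zero_iff]; linarith) xt
      (by rw [mem_closedBall_zero_iff]; linarith)
    rw [dist_eq_norm, dist_eq_norm] at h1
    exact (le_abs_self _).trans h1
  constructor
  · have h1 : L_F * ‖xo - xt‖ ≤ ρ * (R * √Λ) * (t * R / √Λ / bigA L N) :=
      mul_le_mul hLFρ hdiff (norm_nonneg _) (L_F.2.trans hLFρ)
    -- The noise costs at most `ρ t R² ≤ R²` on the scale of `A_N`; with the `4 R²` of the exact
    -- average this is the `5 R²` allowed for `A_N ε`.
    have h2 : bigA L N * (ρ * (R * √Λ) * (t * R / √Λ / bigA L N)) = ρ * t * R ^ 2 := by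
      field_simp
    have h3 : ρ * t * R ^ 2 ≤ 1 * R ^ 2 := by gcongr
    refine le_of_mul_le_mul_left ?_ hA
    have h4 := mul_le_mul_of_nonneg_left (hF1.trans h1) hA.le
    rw [h2] at h4
    nlinarith
  · rw [le_div_iff₀ hR]
    refine le_of_mul_le_mul_left ?_ hA
    have h1 : ‖B xo‖ ≤ ‖B xt‖ + (bigA L N)⁻¹ * (t * R) := by
      rw [hout, map_add, map_smul]
      refine (norm_add_le _ _).trans ?_
      rw [norm_smul, norm_inv, Real.norm_of_nonneg hA.le]
      gcongr
    have h2 : bigA L N * (‖B xo‖ * R) ≤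
        bigA L N * ((‖B xt‖ + (bigA L N)⁻¹ * (t * R)) * R) := by gcongr
    have h3 : bigA L N * ((‖B xt‖ + (bigA L N)⁻¹ * (t * R)) * R) =
        bigA L N * (R * ‖B xt‖) + t * R ^ 2 := by field_simp
    have h4 : t * R ^ 2 ≤ 1 * R ^ 2 := by gcongr; linarith
    linarith

end Deterministic

/-! ### Probability of the small-noise event -/

section NoiseEvents

variable {m n : ℕ} {Ξ : Type*} [mΞ : MeasurableSpace Ξ] {ν : Measure Ξ} [IsProbabilityMeasure ν]
  {F : Stacked m n → ℝ} {S : StochasticDual ν F}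
  {W : Matrix (Fin m × Fin n) (Fin m × Fin n) ℝ} {L μ σ l : ℝ} {r : ℕ → ℕ}
  {Ω : Type*} [mΩ : MeasurableSpace Ω] {P : Measure Ω} [IsProbabilityMeasure P]
  {ξ : ℕ → ℕ → Ω → Ξ} {N : ℕ}

theorem natCast_mul_div_sq (b : ℝ) (r : ℕ) : (r : ℝ) * (b / r) ^ 2 = b ^ 2 / r := by
  rcases eq_or_ne (r : ℝ) 0 with h | h
  · simp [h]
  · field_simp

/-- Large deviations of weighted sums of the batch noises. -/
theorem measure_sum_batchNoise_le (hμ : 0 < μ) (hF : StrongConvexOn Set.univ μ F) (hσ : 0 < σ)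
    (hS : S.LightTail σ) (hξ : ∀ k s, Measurable (ξ k s)) (hlaw : ∀ k s, P.map (ξ k s) = ν)
    (hind : iIndepFun (fun p : ℕ × ℕ => ξ p.1 p.2) P) (hr : ∀ k ∈ Finset.Icc 1 N, 0 < r k)
    (hl : 1 ≤ l) (β : ℕ → ℝ) {v : ℝ} (hv : 0 < v)
    (hβ : σ ^ 2 * ∑ j ∈ Finset.range N, β (j + 1) ^ 2 / r (j + 1) ≤ v) :
    P {ω | 10 * l * v < ‖∑ j ∈ Finset.range N,
      β (j + 1) • batchNoise S W L r (fun k s => ξ k s ω) (j + 1)‖ ^ 2} ≤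
        ENNReal.ofReal (Real.exp (-l)) := by
  have hh : Measurable (Function.uncurry fun (y : Stacked m n) x => S.noise (sqrtOp W y) x) :=
    S.measurable_noise_sqrtOp hμ hF W
  have h := measure_rowSum_ge_le (P := P) (ν := ν) (σ := σ) (l := l) (v := v) (k := N) (r := r)
    (c := fun j => β j / r j) (h := fun y x => S.noise (sqrtOp W y) x)
    (U := fun k ω => (run S W L r (fun k s => ξ k s ω) k).lam) hσ hξ hlaw hind hh
    (fun y => (S.integral_noise hμ hF hσ hS _).2) (fun y => hS _)
    (fun k => measurable_run_lam S W L r ξ k) hv hl (by simpa only [natCast_mul_div_sq] using hβ)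
  have heq : ∀ ω, ∑ j ∈ Finset.range N,
      β (j + 1) • batchNoise S W L r (fun k s => ξ k s ω) (j + 1) =
      rowSum (fun j => β j / r j) r (fun y x => S.noise (sqrtOp W y) x)
        (fun k ω => (run S W L r (fun k s => ξ k s ω) k).lam) ξ N ω := fun ω => by
    refine Finset.sum_congr rfl fun j hj => ?_
    rw [batchNoise_eq _ (hr _ (Finset.mem_Icc.2 ⟨by omega, Finset.mem_range.1 hj⟩)), smul_smul,
      ← div_eq_mul_inv]
  simp_rw [heq]
  exact h

/-- Large deviations of the inner products of the noise with truncated predictable directions. -/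
theorem measure_sum_inner_batchNoise_le (hμ : 0 < μ) (hF : StrongConvexOn Set.univ μ F)
    (hσ : 0 < σ) (hS : S.LightTail σ) (hξ : ∀ k s, Measurable (ξ k s))
    (hlaw : ∀ k s, P.map (ξ k s) = ν) (hind : iIndepFun (fun p : ℕ × ℕ => ξ p.1 p.2) P)
    (hr : ∀ k ∈ Finset.Icc 1 N, 0 < r k) (hl : 1 ≤ l) {Λ R v : ℝ} (hΛ : 0 < Λ) (hR : 0 < R)
    (hW : ∀ u, ‖sqrtOp W u‖ ≤ √Λ * ‖u‖) (w : Stacked m n) (hv : 0 < v) {k : ℕ} (hk : k ≤ N)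
    (hα : (√Λ * R * σ) ^ 2 * ∑ j ∈ Finset.range N, alpha L (j + 1) ^ 2 / r (j + 1) ≤ v) :
    P {ω | 10 * l * v < |∑ j ∈ Finset.range k, alpha L (j + 1) *
      ⟪sqrtOp W (batchNoise S W L r (fun k s => ξ k s ω) (j + 1)),
        truncate R (w - (run S W L r (fun k s => ξ k s ω) j).zeta)⟫_ℝ| ^ 2} ≤
        ENNReal.ofReal (Real.exp (-l)) := by
  have hΛ' : 0 < √Λ := Real.sqrt_pos.2 hΛ
  set h : Stacked m n × Stacked m n → Ξ → ℝ := fun y x =>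
    ⟪sqrtOp W (S.noise (sqrtOp W y.1) x), truncate R (w - y.2)⟫_ℝ with hdef
  have htr : Measurable (truncate R : Stacked m n → Stacked m n) := by
    unfold truncate
    exact Measurable.ite (measurableSet_le measurable_norm measurable_const) measurable_id
      measurable_const
  have hh : Measurable (Function.uncurry h) := by
    have h1 : Measurable fun q : (Stacked m n × Stacked m n) × Ξ =>
        S.noise (sqrtOp W q.1.1) q.2 :=
      (S.measurable_noise_sqrtOp hμ hF W).comp
        (g := fun q : Stacked m n × Ξ => S.noise (sqrtOp W q.1) q.2)
        (f := fun q : (Stacked m n × Stacked m n) × Ξ => (q.1.1, q.2))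
        ((measurable_fst.comp measurable_fst).prodMk measurable_snd)
    have h2 : Measurable fun q : (Stacked m n × Stacked m n) × Ξ => truncate R (w - q.1.2) :=
      htr.comp (measurable_const.sub (measurable_snd.comp measurable_fst))
    exact ((sqrtOp W).continuous.measurable.comp h1).inner h2
  have hmean : ∀ y, ∫ x, h y x ∂ν = 0 := fun y => by
    obtain ⟨hi, h0⟩ := S.integral_noise hμ hF hσ hS (sqrtOp W y.1)
    have h1 : ∀ x, h y x =
        ⟪sqrtOp W (truncate R (w - y.2)), S.noise (sqrtOp W y.1) x⟫_ℝ := fun x => by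
      rw [hdef]
      simp only
      rw [real_inner_comm, sqrtOp_inner_left]
    simp_rw [h1]
    rw [integral_inner hi, h0, inner_zero_right]
  have htail : ∀ y, ∫⁻ x, ENNReal.ofReal (Real.exp (‖h y x‖ ^ 2 / (√Λ * R * σ) ^ 2)) ∂ν
      ≤ ENNReal.ofReal (Real.exp 1) := fun y => by
    refine le_trans (lintegral_mono fun x => ENNReal.ofReal_le_ofReal (Real.exp_le_exp.2 ?_))
      (hS (sqrtOp W y.1))
    change ‖h y x‖ ^ 2 / (√Λ * R * σ) ^ 2 ≤ ‖S.noise (sqrtOp W y.1) x‖ ^ 2 / σ ^ 2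
    have h1 : ‖h y x‖ ≤ √Λ * R * ‖S.noise (sqrtOp W y.1) x‖ := by
      refine (norm_inner_le_norm _ _).trans ?_
      calc _ ≤ √Λ * ‖S.noise (sqrtOp W y.1) x‖ * R :=
            mul_le_mul (hW _) (norm_truncate_le hR.le _) (norm_nonneg _) (by positivity)
        _ = _ := by ring
    rw [div_le_div_iff₀ (by positivity) (by positivity)]
    calc ‖h y x‖ ^ 2 * σ ^ 2 ≤ (√Λ * R * ‖S.noise (sqrtOp W y.1) x‖) ^ 2 * σ ^ 2 := by gcongr
      _ = _ := by ring
  have hU : ∀ k, Measurable[sigmaOf ξ (rowsUpTo k)] fun ω =>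
      ((run S W L r (fun k s => ξ k s ω) (k + 1)).lam,
        (run S W L r (fun k s => ξ k s ω) k).zeta) := fun k =>
    (measurable_run_lam S W L r ξ k).prodMk (measurable_run S W L r ξ k).1
  have hsum : (√Λ * R * σ) ^ 2 *
      ∑ j ∈ Finset.range k, (r (j + 1) : ℝ) * (alpha L (j + 1) / r (j + 1)) ^ 2 ≤ v := by
    simp only [natCast_mul_div_sq]
    refine le_trans ?_ hα
    refine mul_le_mul_of_nonneg_left ?_ (by positivity)
    exact Finset.sum_le_sum_of_subset_of_nonneg (Finset.range_mono hk) fun _ _ _ => by positivity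
  have key := measure_rowSum_ge_le (P := P) (ν := ν) (σ := √Λ * R * σ) (l := l) (v := v) (k := k)
    (r := r) (c := fun j => alpha L j / r j) (h := h)
    -- The parameter for row `k + 1` pairs the query point with the `zeta` of the preceding
    -- iteration, both determined by the first `k` rows. Only positive indices enter `rowSum`, so `k
    -- - 1` is never truncated.
    (U := fun k ω => ((run S W L r (fun k s => ξ k s ω) k).lam,
      (run S W L r (fun k s => ξ k s ω) (k - 1)).zeta))
    (by positivity) hξ hlaw hind hh hmean htail hU hv hl hsum
  have heq : ∀ ω, ∑ j ∈ Finset.range k, alpha L (j + 1) *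
      ⟪sqrtOp W (batchNoise S W L r (fun k s => ξ k s ω) (j + 1)),
        truncate R (w - (run S W L r (fun k s => ξ k s ω) j).zeta)⟫_ℝ =
      rowSum (fun j => alpha L j / r j) r h
        (fun k ω => ((run S W L r (fun k s => ξ k s ω) k).lam,
          (run S W L r (fun k s => ξ k s ω) (k - 1)).zeta)) ξ k ω := fun ω => by
    refine Finset.sum_congr rfl fun j hj => ?_
    have hj' := Finset.mem_range.1 hj
    rw [batchNoise_eq _ (hr _ (Finset.mem_Icc.2 ⟨by omega, by omega⟩)), map_smul, map_sum,
      real_inner_smul_left, sum_inner, ← mul_assoc, smul_eq_mul, ← div_eq_mul_inv]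
    simp only [hdef, Nat.add_sub_cancel]
  simp_rw [heq, ← Real.norm_eq_abs]
  exact key

/-- With high probability all noise terms of the analysis are small simultaneously. -/
theorem noise_small_with_high_probability (hμ : 0 < μ) (hF : StrongConvexOn Set.univ μ F)
    (hσ : 0 < σ) (hS : S.LightTail σ) (hξ : ∀ k s, Measurable (ξ k s))
    (hlaw : ∀ k s, P.map (ξ k s) = ν) (hind : iIndepFun (fun p : ℕ × ℕ => ξ p.1 p.2) P)
    (hL : 0 < L) (hN : N ≠ 0) (hr : ∀ k ∈ Finset.Icc 1 N, 0 < r k) {δ Λ R t : ℝ} (hδ : 0 < δ)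
    (hl : 3 ≤ Real.log (N / δ)) (hΛ : 0 < Λ) (hR : 0 < R) (ht : 0 ≤ t)
    (hW : ∀ u, ‖sqrtOp W u‖ ≤ √Λ * ‖u‖) (w : Stacked m n)
    (hvar : 10 * Real.log (N / δ) * (Λ * σ ^ 2 *
      ∑ j ∈ Finset.range N, alpha L (j + 1) ^ 2 / r (j + 1)) ≤ t ^ 2 * R ^ 2) :
    ENNReal.ofReal (1 - 4 * δ) ≤ P {ω |
      (∀ k ≤ N, |∑ j ∈ Finset.range k, alpha L (j + 1) *
        ⟪sqrtOp W (batchNoise S W L r (fun k s => ξ k s ω) (j + 1)),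
          truncate (2 * R) (w - (run S W L r (fun k s => ξ k s ω) j).zeta)⟫_ℝ| ≤ 2 * t * R ^ 2) ∧
      (∑ j ∈ Finset.range N, Λ *
        ‖alpha L (j + 1) • batchNoise S W L r (fun k s => ξ k s ω) (j + 1)‖ ^ 2 ≤ t ^ 2 * R ^ 2) ∧
      √Λ * ‖∑ j ∈ Finset.range N,
        alpha L (j + 1) • batchNoise S W L r (fun k s => ξ k s ω) (j + 1)‖ ≤ t * R} := by
  set l := Real.log (N / δ) with hldef
  have hN1 : 1 ≤ N := Nat.one_le_iff_ne_zero.2 hN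
  have hN0 : (0 : ℝ) < N := by positivity
  have hexp : Real.exp (-l) = δ / N := by
    rw [Real.exp_neg, hldef, Real.exp_log (by positivity), inv_div]
  have hr' : ∀ j ∈ Finset.range N, (0 : ℝ) < r (j + 1) := fun j hj =>
    Nat.cast_pos.2 (hr _ (Finset.mem_Icc.2 ⟨by omega, Finset.mem_range.1 hj⟩))
  have hterm : ∀ j ∈ Finset.range N, 0 < alpha L (j + 1) ^ 2 / r (j + 1) := fun j hj => by
    have := alpha_succ_pos hL j
    have := hr' j hj
    positivity
  set V := ∑ j ∈ Finset.range N, alpha L (j + 1) ^ 2 / r (j + 1) with hV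
  have hVpos : 0 < V := Finset.sum_pos hterm ⟨0, Finset.mem_range.2 hN1⟩
  have hsΛ : √Λ ^ 2 = Λ := Real.sq_sqrt hΛ.le
  set e : Ω → ℕ → Stacked m n := fun ω => batchNoise S W L r (fun k s => ξ k s ω) with he
  -- Bad events: `A i` for a single iteration's noise, `T` for the weighted total, `D i` for the
  -- inner products up to iteration `i + 1`. Avoiding all `A i` bounds the sum of squares termwise.
  set A : ℕ → Set Ω := fun i => {ω | 10 * l * (σ ^ 2 * (alpha L (i + 1) ^ 2 / r (i + 1))) <
    ‖alpha L (i + 1) • e ω (i + 1)‖ ^ 2} with hA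
  set T : Set Ω := {ω | 10 * l * (σ ^ 2 * V) <
    ‖∑ j ∈ Finset.range N, alpha L (j + 1) • e ω (j + 1)‖ ^ 2} with hT
  set D : ℕ → Set Ω := fun i => {ω | 10 * l * ((√Λ * (2 * R) * σ) ^ 2 * V) <
    |∑ j ∈ Finset.range (i + 1), alpha L (j + 1) * ⟪sqrtOp W (e ω (j + 1)),
      truncate (2 * R) (w - (run S W L r (fun k s => ξ k s ω) j).zeta)⟫_ℝ| ^ 2} with hD
  have hPA : ∀ i ∈ Finset.range N, P (A i) ≤ ENNReal.ofReal (δ / N) := fun i hi => by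
    -- A single iteration is the weighted sum whose weights vanish off one index.
    have h1 := measure_sum_batchNoise_le (W := W) (L := L) hμ hF hσ hS hξ hlaw hind hr
      (by linarith : 1 ≤ l) (fun j => if j = i + 1 then alpha L j else 0)
      (v := σ ^ 2 * (alpha L (i + 1) ^ 2 / r (i + 1)))
      (mul_pos (by positivity) (hterm i hi))
      (by
        refine le_of_eq ?_
        congr 1
        rw [Finset.sum_eq_single_of_mem i hi fun j _ hj => by simp [hj]]
        simp)
    rw [← hexp]
    refine le_trans (le_of_eq ?_) h1
    congr 1
    ext ω
    simp only [hA, Set.mem_ofPred_eq]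
    rw [Finset.sum_eq_single_of_mem i hi fun j _ hj => by simp [hj]]
    simp [he]
  have hPT : P T ≤ ENNReal.ofReal (δ / N) := by
    rw [← hexp]
    exact measure_sum_batchNoise_le hμ hF hσ hS hξ hlaw hind hr (by linarith) (alpha L)
      (by positivity) le_rfl
  have hPD : ∀ i ∈ Finset.range N, P (D i) ≤ ENNReal.ofReal (δ / N) := fun i hi => by
    rw [← hexp]
    exact measure_sum_inner_batchNoise_le hμ hF hσ hS hξ hlaw hind hr (by linarith) hΛ
      (by positivity) hW w (by positivity) (Finset.mem_range.1 hi) le_rfl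
  set good : Set Ω := {ω |
      (∀ k ≤ N, |∑ j ∈ Finset.range k, alpha L (j + 1) * ⟪sqrtOp W (e ω (j + 1)),
          truncate (2 * R) (w - (run S W L r (fun k s => ξ k s ω) j).zeta)⟫_ℝ| ≤ 2 * t * R ^ 2) ∧
      (∑ j ∈ Finset.range N, Λ * ‖alpha L (j + 1) • e ω (j + 1)‖ ^ 2 ≤ t ^ 2 * R ^ 2) ∧
      √Λ * ‖∑ j ∈ Finset.range N, alpha L (j + 1) • e ω (j + 1)‖ ≤ t * R} with hgood
  have hcover : (Set.univ : Set Ω) ⊆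
      good ∪ ((⋃ i ∈ Finset.range N, A i) ∪ T ∪ ⋃ i ∈ Finset.range N, D i) := by
    intro ω _
    by_contra hω
    simp only [Set.mem_union, not_or, Set.mem_iUnion, not_exists] at hω
    obtain ⟨hg, ⟨hA', hT'⟩, hD'⟩ := hω
    refine hg ⟨fun k hk => ?_, ?_, ?_⟩
    · rcases k with _ | k
      · simp; positivity
      have h1 := hD' k (Finset.mem_range.2 hk)
      simp only [hD, Set.mem_ofPred_eq, not_lt] at h1
      refine le_of_sq_le_sq (h1.trans ?_) (by positivity)
      rw [mul_pow, mul_pow, hsΛ]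
      calc 10 * l * (Λ * (2 * R) ^ 2 * σ ^ 2 * V) = 4 * R ^ 2 * (10 * l * (Λ * σ ^ 2 * V)) := by
            ring
        _ ≤ 4 * R ^ 2 * (t ^ 2 * R ^ 2) := by gcongr
        _ = _ := by ring
    · refine le_trans (Finset.sum_le_sum fun j hj =>
        mul_le_mul_of_nonneg_left (not_lt.1 (hA' j hj)) hΛ.le) (le_trans (le_of_eq ?_) hvar)
      rw [← Finset.mul_sum, ← Finset.mul_sum, ← Finset.mul_sum]
      ring
    · refine le_of_sq_le_sq ?_ (by positivity)
      rw [mul_pow, mul_pow, hsΛ]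
      refine le_trans (mul_le_mul_of_nonneg_left (not_lt.1 hT') hΛ.le) (le_trans (le_of_eq ?_) hvar)
      ring
  have hsumN : ∀ Z : ℕ → Set Ω, (∀ i ∈ Finset.range N, P (Z i) ≤ ENNReal.ofReal (δ / N)) →
      P (⋃ i ∈ Finset.range N, Z i) ≤ ENNReal.ofReal δ := fun Z hZ => by
    refine (measure_biUnion_finset_le _ _).trans ((Finset.sum_le_sum hZ).trans ?_)
    rw [Finset.sum_const, Finset.card_range, nsmul_eq_mul, ← ENNReal.ofReal_natCast,
      ← ENNReal.ofReal_mul hN0.le, mul_div_cancel₀ _ hN0.ne']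
  have hT' : P T ≤ ENNReal.ofReal δ := hPT.trans (ENNReal.ofReal_le_ofReal
    (div_le_self hδ.le (by exact_mod_cast hN1)))
  -- There are `2 N + 1` events of probability at most `δ / N`, hence at most `3 δ` in total.
  have hbad : P ((⋃ i ∈ Finset.range N, A i) ∪ T ∪ ⋃ i ∈ Finset.range N, D i) ≤
      ENNReal.ofReal (4 * δ) := by
    refine (measure_union_le _ _).trans ((add_le_add ((measure_union_le _ _).trans
      (add_le_add (hsumN A hPA) hT')) (hsumN D hPD)).trans ?_)
    rw [← ENNReal.ofReal_add hδ.le hδ.le, ← ENNReal.ofReal_add (by positivity) hδ.le]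
    exact ENNReal.ofReal_le_ofReal (by linarith)
  rw [ENNReal.ofReal_sub _ (by positivity), ENNReal.ofReal_one, tsub_le_iff_right]
  calc 1 = P Set.univ := measure_univ.symm
    _ ≤ P good + P _ := (measure_mono hcover).trans (measure_union_le _ _)
    _ ≤ _ := by gcongr

end NoiseEvents

/-! ### Iteration count, variance and number of oracle calls -/

section Budget

variable {L ε δ H R Λ σ c : ℝ} {N : ℕ} {r : ℕ → ℕ}

theorem bigA_mul_le (hL : 0 < L) (hε : 0 < ε)
    (hN : N ≤ H * √(L * R ^ 2 / ε)) : bigA L N * ε ≤ H ^ 2 * R ^ 2 / 2 := by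
  have h1 := pow_le_pow_left₀ (Nat.cast_nonneg N) hN 2
  rw [mul_pow, Real.sq_sqrt (by positivity)] at h1
  calc bigA L N * ε ≤ (N : ℝ) ^ 2 / (2 * L) * ε := by gcongr; exact bigA_le hL N
    _ ≤ H ^ 2 * (L * R ^ 2 / ε) / (2 * L) * ε := by gcongr
    _ = _ := by field_simp

theorem le_bigA_mul (hL : 0 < L) (hε : 0 < ε) (hN : 7 * √(L * R ^ 2 / ε) ≤ N) :
    5 * R ^ 2 ≤ bigA L N * ε := by
  have h1 := pow_le_pow_left₀ (by positivity) hN 2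
  rw [mul_pow, Real.sq_sqrt (by positivity)] at h1
  calc 5 * R ^ 2 ≤ 7 ^ 2 * (L * R ^ 2 / ε) / (8 * L) * ε := by
        have : 7 ^ 2 * (L * R ^ 2 / ε) / (8 * L) * ε = 49 / 8 * R ^ 2 := by field_simp; ring
        rw [this]
        nlinarith [sq_nonneg R]
    _ ≤ (N : ℝ) ^ 2 / (8 * L) * ε := by gcongr
    _ ≤ _ := by gcongr; exact le_bigA hL N

/-- The variance accumulated with the prescribed batch sizes. -/
theorem variance_le (hL : 0 < L) (hε : 0 < ε) (hl : 0 < Real.log (N / δ)) (hΛ : 0 < Λ)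
    (hσ : 0 < σ) (hc : 0 < c)
    (hr : ∀ k ∈ Finset.Icc 1 N, c * batchScale L (Λ * σ ^ 2) ε δ N k ≤ r k) :
    Real.log (N / δ) * (Λ * σ ^ 2 * ∑ j ∈ Finset.range N, alpha L (j + 1) ^ 2 / r (j + 1)) ≤
      bigA L N * ε / c := by
  rw [← mul_assoc, Finset.mul_sum, bigA_eq_sum, Finset.sum_mul, Finset.sum_div]
  refine Finset.sum_le_sum fun j hj => ?_
  have ha := alpha_succ_pos hL j
  have h1 := hr (j + 1) (Finset.mem_Icc.2 ⟨by omega, Finset.mem_range.1 hj⟩)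
  have h2 : c * (Λ * σ ^ 2 * alpha L (j + 1) * Real.log (N / δ) / ε) ≤ r (j + 1) :=
    (mul_le_mul_of_nonneg_left (le_max_right _ _) hc.le).trans h1
  have h3 : (0 : ℝ) < r (j + 1) := lt_of_lt_of_le (by positivity) h2
  rw [mul_div_assoc', div_le_div_iff₀ h3 hc]
  -- The batch size grows with `α`, cancelling one of the two factors `α` in the variance; the
  -- remaining ones sum to `A_N`.
  have h4 : c * (Λ * σ ^ 2 * alpha L (j + 1) * Real.log (N / δ) / ε) * (alpha L (j + 1) * ε) =
      Real.log (N / δ) * (Λ * σ ^ 2) * alpha L (j + 1) ^ 2 * c := by field_simp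
  rw [← h4, mul_comm (alpha L (j + 1) * ε)]
  gcongr

theorem calls_le (hL : 0 < L) (hε : 0 < ε) (hl : 0 < Real.log (N / δ)) (hΛ : 0 < Λ)
    (hc : 0 < c) (hr : ∀ k ∈ Finset.Icc 1 N, r k ≤ c * batchScale L (Λ * σ ^ 2) ε δ N k) :
    (∑ j ∈ Finset.range N, (r (j + 1) : ℝ)) ≤
      c * (N + Λ * σ ^ 2 * Real.log (N / δ) / ε * bigA L N) := by
  have h : ∀ j ∈ Finset.range N, (r (j + 1) : ℝ) ≤
      c * (1 + Λ * σ ^ 2 * Real.log (N / δ) / ε * alpha L (j + 1)) := fun j hj => by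
    refine (hr (j + 1) (Finset.mem_Icc.2 ⟨by omega, Finset.mem_range.1 hj⟩)).trans ?_
    have ha := alpha_succ_pos hL j
    refine mul_le_mul_of_nonneg_left (max_le ?_ ?_) hc.le
    · have : 0 ≤ Λ * σ ^ 2 * Real.log (N / δ) / ε * alpha L (j + 1) := by positivity
      linarith
    · refine le_trans (le_of_eq ?_) (le_add_of_nonneg_left zero_le_one)
      ring
  refine (Finset.sum_le_sum h).trans (le_of_eq ?_)
  rw [← Finset.mul_sum, Finset.sum_add_distrib, ← Finset.mul_sum, ← bigA_eq_sum]
  simp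

/-- The additive `log H` becomes a constant factor because `log (X / δ) ≥ log 4 ≥ 1`. -/
theorem log_iterations_le {X : ℝ} (hδ : 0 < δ) (hδ' : δ < 1 / 4) (hH : 1 ≤ H) (hX : 1 ≤ X)
    (hN : (N : ℝ) ≤ H * X) (hN0 : N ≠ 0) :
    Real.log (N / δ) ≤ (1 + Real.log H) * Real.log (1 / δ * X) := by
  have hN1 : (0 : ℝ) < N := by positivity
  have h1 : Real.log (N / δ) ≤ Real.log (H * (1 / δ * X)) := by
    refine Real.log_le_log (by positivity) ?_
    calc (N : ℝ) / δ ≤ H * X / δ := by gcongr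
      _ = _ := by ring
  rw [Real.log_mul (by positivity) (by positivity)] at h1
  have h2 : 1 ≤ Real.log (1 / δ * X) := by
    rw [Real.le_log_iff_exp_le (by positivity)]
    have h3 : 4 ≤ 1 / δ := by
      rw [le_div_iff₀ hδ]; linarith
    have h4 := Real.exp_one_lt_d9
    nlinarith
  have h5 : 0 ≤ Real.log H := Real.log_nonneg hH
  nlinarith

end Budget

end DualStoch

end

/-! ### The theorem: choice of constants and assembly -/

open DualStoch in
theorem theorem2 :
    ∃ K : ℝ, 0 < K ∧ ∀ H : ℝ, K ≤ H → ∃ κ : ℝ, 0 < κ ∧ ∀ ρ : ℝ, 0 < ρ →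
    ∃ c₀ : ℝ, 0 < c₀ ∧ ∀ c₁ : ℝ, c₀ ≤ c₁ → ∃ C : ℝ, 0 < C ∧
    ∀ (m n : ℕ) (G : SimpleGraph (Fin m)) [DecidableRel G.Adj]
      (f : Fin m → EuclideanSpace ℝ (Fin n) → ℝ)
      (W : Matrix (Fin m × Fin n) (Fin m × Fin n) ℝ) (F : Stacked m n → ℝ)
      (Ξ : Type*) [MeasurableSpace Ξ] (ν : Measure Ξ) [IsProbabilityMeasure ν]
      (S : StochasticDual ν F)
      (Ω : Type*) [MeasurableSpace Ω] (P : Measure Ω) [IsProbabilityMeasure P]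
      (ξ : ℕ → ℕ → Ω → Ξ)
      (μ M_F ε δ L σ_x R_y R_F : ℝ) (L_F : ℝ≥0) (xstar ystar : Stacked m n)
      (N : ℕ) (r : ℕ → ℕ),
      -- the network and the objective
      G.Connected → W = commMatrix n G → F = stackedSum f →
      0 < μ → StrongConvexOn Set.univ μ F →
      xstar ∈ consensus m n → IsMinOn F (consensus m n) xstar →
      DifferentiableAt ℝ F xstar → ‖gradient F xstar‖ = M_F →
      -- smoothness parameter and solution of the dual problem
      0 < L → L ≤ lamMax W / μ →
      (∀ y z, ‖gradient (dualObj W F) y - gradient (dualObj W F) z‖ ≤ L * ‖y - z‖) →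
      IsMinOn (dualObj W F) Set.univ ystar →
      0 < R_y → ‖ystar‖ ≤ R_y → R_y ^ 2 ≤ M_F ^ 2 / lamMinPos W →
      -- the oracle and independent samples
      0 < σ_x → S.LightTail σ_x →
      (∀ k s, Measurable (ξ k s)) → (∀ k s, P.map (ξ k s) = ν) →
      iIndepFun (fun p : ℕ × ℕ => ξ p.1 p.2) P →
      -- accuracy, confidence level, number of iterations
      0 < ε → 0 < δ → δ < 1 / 4 → 3 ≤ Real.log (N / δ) →
      K * √(L * R_y ^ 2 / ε) ≤ N → N ≤ H * √(L * R_y ^ 2 / ε) →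
      -- batch sizes
      (∀ k ∈ Finset.Icc 1 N, c₀ * batchScale L (lamMax W * σ_x ^ 2) ε δ N k ≤ r k) →
      -- Lipschitz continuity on a ball
      κ * max (R_y / bigA L N * √(1 / lamMax W))
        (max (√(lamMax W) * R_y / μ) ‖primalPoint F (sqrtOp W ystar)‖) ≤ R_F →
      LipschitzOnWith L_F F (Metric.closedBall 0 R_F) →
      L_F ≤ ρ * (R_y * √(lamMax W)) →
      -- conclusions
      (N : ℝ) ≤ H * √(M_F ^ 2 / (μ * ε) * condNumber W) ∧
      ENNReal.ofReal (1 - 4 * δ) ≤ P {ω |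
        F (output S W L r (fun k s => ξ k s ω) N) - F xstar ≤ ε ∧
        ‖sqrtOp W (output S W L r (fun k s => ξ k s ω) N)‖ ≤ ε / R_y} ∧
      (μ * ε ≤ M_F ^ 2 * condNumber W →
        (∀ k ∈ Finset.Icc 1 N, r k ≤ c₁ * batchScale L (lamMax W * σ_x ^ 2) ε δ N k) →
        ∀ ω, ((run S W L r (fun k s => ξ k s ω) N).calls : ℝ) ≤
          C * max (lamMax W * σ_x ^ 2 * M_F ^ 2 / (ε ^ 2 * lamMinPos W) *
              Real.log (1 / δ * √(M_F ^ 2 / (μ * ε) * condNumber W)))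
            (√(M_F ^ 2 / (μ * ε) * condNumber W))) := by
  -- `K = 7` gives `A_N ε ≥ 49 R² / 8 ≥ 5 R²`; `κ = 4` is the radius factor of `output_accuracy`.
  -- The noise level `t` below is at most `1 / 4` for the iterates to stay bounded and at most `1 /
  -- ρ` for the Lipschitz transfer.
  refine ⟨7, by norm_num, fun H hH => ⟨4, by norm_num, fun ρ hρ => ?_⟩⟩
  set t : ℝ := min (1 / 4) (1 / ρ) with ht
  have ht0 : 0 < t := lt_min (by norm_num) (by positivity)
  have ht4 : t ≤ 1 / 4 := min_le_left _ _
  have htρ : ρ * t ≤ 1 := by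
    calc ρ * t ≤ ρ * (1 / ρ) := by gcongr; exact min_le_right _ _
      _ = 1 := by field_simp
  have hH0 : 0 < H := by linarith
  have hc0 : 0 < 5 * H ^ 2 / t ^ 2 := by positivity
  -- Chosen so that `10 (H² R² / 2) / c₀ = t² R²`, where `H² R² / 2` bounds `A_N ε` and `10` comes
  -- from the tail bound.
  refine ⟨5 * H ^ 2 / t ^ 2, hc0, fun c₁ hc₁ => ?_⟩
  have hc₁0 : 0 < c₁ := hc0.trans_le hc₁
  have hlogH : 0 ≤ Real.log H := Real.log_nonneg (by linarith)
  refine ⟨c₁ * (H + H ^ 2 / 2 * (1 + Real.log H)), by positivity, ?_⟩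
  intro m n G _ f W F Ξ _ ν _ S Ω _ P _ ξ μ M_F ε δ L σ_x R_y R_F L_F xstar ystar N r
    hG hW _ hμ hF hxc hxmin _ _ hL hLΛ hlip hymin hR hyR hRM hσ hS hξ hlaw hind hε hδ hδ4 hl
    hKN hNH hr hRF hLF hLFρ
  subst hW
  have hΛ : 0 < lamMax (commMatrix n G) := by
    have := hL.trans_le hLΛ
    by_contra! h
    exact absurd this (not_lt.2 (div_nonpos_of_nonpos_of_nonneg h hμ.le))
  have hmin := lamMinPos_pos hΛ
  have hN1 : (0 : ℝ) < N := lt_of_lt_of_le (by positivity) hKN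
  have hN0 : N ≠ 0 := by
    rintro rfl
    simp at hN1
  have hl0 : 0 < Real.log (N / δ) := by linarith
  have hr0 : ∀ k ∈ Finset.Icc 1 N, 0 < r k := fun k hk => by
    have h1 : 0 < batchScale L (lamMax (commMatrix n G) * σ_x ^ 2) ε δ N k :=
      lt_of_lt_of_le one_pos (le_max_left _ _)
    exact_mod_cast (mul_pos hc0 h1).trans_le (hr k hk)
  have hAε := bigA_mul_le hL hε hNH
  -- Here `L ≤ λ_max / μ` and `R² ≤ M_F² / λ_min⁺` turn dual quantities into primal ones.
  have hX : L * R_y ^ 2 / ε ≤ M_F ^ 2 / (μ * ε) * condNumber (commMatrix n G) := by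
    calc L * R_y ^ 2 / ε ≤ lamMax (commMatrix n G) / μ * (M_F ^ 2 / lamMinPos (commMatrix n G)) / ε
        := by gcongr
      _ = _ := by rw [condNumber]; field_simp
  have hNX : (N : ℝ) ≤ H * √(M_F ^ 2 / (μ * ε) * condNumber (commMatrix n G)) :=
    hNH.trans (by gcongr)
  refine ⟨hNX, ?_, ?_⟩
  · have hvar : 10 * Real.log (N / δ) * (lamMax (commMatrix n G) * σ_x ^ 2 *
        ∑ j ∈ Finset.range N, alpha L (j + 1) ^ 2 / r (j + 1)) ≤ t ^ 2 * R_y ^ 2 := by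
      have h1 := variance_le hL hε hl0 hΛ hσ hc0 hr
      have h2 : bigA L N * ε / (5 * H ^ 2 / t ^ 2) ≤
          H ^ 2 * R_y ^ 2 / 2 / (5 * H ^ 2 / t ^ 2) := by gcongr
      have h3 : H ^ 2 * R_y ^ 2 / 2 / (5 * H ^ 2 / t ^ 2) = t ^ 2 * R_y ^ 2 / 10 := by
        field_simp; norm_num
      linarith
    refine (noise_small_with_high_probability hμ hF hσ hS hξ hlaw hind hL hN0 hr0 hδ hl hΛ hR
      ht0.le (norm_sqrtOp_le posSemidef_commMatrix) ystar hvar).trans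
      (measure_mono fun ω hω => ?_)
    exact output_accuracy hG hμ hF hxc hxmin hymin hL hlip hN0 hR hyR ht0.le ht4 htρ hΛ
      (le_bigA_mul hL hε hKN) hRF hLF hLFρ hω.1 hω.2.1 hω.2.2
  · intro hχ hr₁ ω
    set X := √(M_F ^ 2 / (μ * ε) * condNumber (commMatrix n G)) with hXdef
    set Λ := lamMax (commMatrix n G)
    have hX1 : 1 ≤ X := by
      rw [hXdef, Real.one_le_sqrt, div_mul_eq_mul_div, one_le_div (by positivity)]
      exact hχ
    rw [run_calls, Nat.cast_sum]
    refine (calls_le hL hε hl0 hΛ hc₁0 hr₁).trans ?_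
    have hlog := log_iterations_le hδ hδ4 (by linarith) hX1 hNX hN0
    set l := Real.log (1 / δ * X)
    set Q := Λ * σ_x ^ 2 * M_F ^ 2 / (ε ^ 2 * lamMinPos (commMatrix n G)) * l with hQ
    have hA2 : bigA L N ≤ H ^ 2 * (M_F ^ 2 / lamMinPos (commMatrix n G)) / 2 / ε := by
      rw [le_div_iff₀ hε]
      refine hAε.trans ?_
      gcongr
    have h1 : Λ * σ_x ^ 2 * Real.log (N / δ) / ε * bigA L N ≤
        H ^ 2 / 2 * (1 + Real.log H) * Q := by
      calc _ ≤ Λ * σ_x ^ 2 * ((1 + Real.log H) * l) / ε *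
            (H ^ 2 * (M_F ^ 2 / lamMinPos (commMatrix n G)) / 2 / ε) := by
            have := hl0.le.trans hlog
            have := bigA_nonneg hL N
            gcongr
        _ = _ := by rw [hQ]; field_simp
    have h2 : H ^ 2 / 2 * (1 + Real.log H) * Q ≤ H ^ 2 / 2 * (1 + Real.log H) * max Q X := by
      gcongr; exact le_max_left _ _
    have h3 : H * X ≤ H * max Q X := by gcongr; exact le_max_right _ _
    calc _ ≤ c₁ * (H * max Q X + H ^ 2 / 2 * (1 + Real.log H) * max Q X) :=
          mul_le_mul_of_nonneg_left (add_le_add (hNX.trans h3) (h1.trans h2)) hc₁0.le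
      _ = _ := by ring
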